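/- Let $m\ge 2$ and let $O_1,\dots,O_N\subset\mathbb R^m$ be pairwise disjoint, strictly convex compact sets with non-empty interior, with $C^2$ boundary and with diameter less than $\sqrt2/4$, all contained in the open unit cube $(0,1)^m$. Assume that 1. for every coordinate projection $\pi_i(x)=x_i$ and all $r\ne s$, $\pi_i(O_r)\cap\pi_i(O_s)=\emptyset$; 2. (no eclipse) for all pairwise distinct $r,s,t$, the convex hull of $O_r\cup O_s$ does not meet $O_t$. For $k\in\mathbb Z^m$ put $O_{(k,r)}=O_r+k$. Consider the billiard on the torus $\mathbb T^m=\mathbb R^m/\mathbb Z^m$ outside the projections of $O_1,\dots,O_N$, lifted to $\Omega=\overline{\mathbb R^m\setminus\bigcup_{k,r}O_{(k,r)}}$. An obstacle $O_{(k,r)}$ is between $O_{(i,s)}$ and $O_{(j,t)}$ if $(k,r)\ne(i,s)$, $(k,r)\neq(j,t)$ and $O_{(k,r)}$ meets the convex hull of $O_{(i,s)}\cup O_{(j,t)}$. A finite sequence $(k_n,r_n)_{n=0}^p$ in $\mathbb Z^m\times\{1,\dots,N\}$ is called admissible if $k_0=0$; $(k_{n+1},r_{n+1})\ne(k_n,r_n)$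 for $0\le n<p$; for $0\le n<p$ no obstacle is between $O_{(k_n,r_n)}$ and $O_{(k_{n+1},r_{n+1})}$; and for $0\le n<p-1$ the obstacle $O_{(k_{n+1},r_{n+1})}$ is not between $O_{(k_n,r_n)}$ and $O_{(k_{n+2},r_{n+2})}$. A trajectory piece of type $(k_n,r_n)_{n=0}^p$ is a broken line in $\Omega$ with successive vertices $x_n\in\partial O_{(k_n,r_n)}$, $0\le n\le p$, $x_n\ne x_{n+1}$ for $0\le n<p$, such that at every $x_n$ with $0<n<p$ the direction of motion is reflected in the tangent hyperplane of $O_{(k_n,r_n)}$ at $x_n$ (the angle of incidence equals the angle of reflection). Its displacement is $d(T)=x_p-x_0\in\mathbb R^m$ and its length is $|T|=\sum_{n<p}\|x_{n+1}-x_n\|$. Let the admissible rotation set $AR\subset\mathbb R^m$ be the set of all limit points of sequences $\bigl(d(T_n)/|T_n|\bigr)_{n\ge1}$, where each $T_n$ is a trajectory piece whose type is a finite admissible sequence, and $|T_n|\to\infty$. Theorem. The set $AR$ is convex. -/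

import Mathlib

open Set Filter Topology

noncomputable section

namespace TorusBilliard

/-- The universal cover of the `m`-dimensional torus, with its Euclidean norm. -/
abbrev Space (m : ℕ) : Type := EuclideanSpace ℝ (Fin m)

/-- Indices `(k, r)` of the obstacles on the universal cover: a lattice vector `k` and the
number `r` of an obstacle on the torus. -/
abbrev Index (m N : ℕ) : Type := (Fin m → ℤ) × Fin N

/-- A subset of `ℝ^m` has `C^2` boundary: near each of its boundary points it is the sublevel set
`{f ≤ 0}` of a `C^2` function without critical points. -/
def HasC2Boundary {m : ℕ} (S : Set (Space m)) : Prop :=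
  ∀ x ∈ frontier S, ∃ U : Set (Space m), IsOpen U ∧ x ∈ U ∧ ∃ f : Space m → ℝ,
    ContDiffOn ℝ 2 f U ∧ (∀ y ∈ U, fderiv ℝ f y ≠ 0) ∧ ∀ y ∈ U, (y ∈ S ↔ f y ≤ 0)

/-- The standing assumptions on the obstacles. The set `O r` is the copy of the `r`-th obstacle
that lies in the unit cube. -/
structure IsObstacleFamily {m N : ℕ} (O : Fin N → Set (Space m)) : Prop where
  isCompact : ∀ r, IsCompact (O r)
  strictConvex : ∀ r, StrictConvex ℝ (O r)
  interior_nonempty : ∀ r, (interior (O r)).Nonempty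
  hasC2Boundary : ∀ r, HasC2Boundary (O r)
  diam_lt : ∀ r, Metric.diam (O r) < Real.sqrt 2 / 4
  /-- The obstacles lie in the interior of the unit cube. -/
  subset_cube : ∀ r, ∀ x ∈ O r, ∀ i, x i ∈ Ioo (0 : ℝ) 1
  disjoint : ∀ r s, r ≠ s → Disjoint (O r) (O s)
  /-- The coordinate projections of different obstacles are disjoint. -/
  disjoint_proj : ∀ i r s, r ≠ s →
    Disjoint ((fun x : Space m => x i) '' O r) ((fun x : Space m => x i) '' O s)
  /-- The no-eclipse condition in the unit cube. -/
  no_eclipse : ∀ r s t, r ≠ s → t ≠ r → t ≠ s → Disjoint (convexHull ℝ (O r ∪ O s)) (O t)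

/-- An integer vector as a point of `ℝ^m`. -/
def latticePoint {m : ℕ} (k : Fin m → ℤ) : Space m := WithLp.toLp 2 fun i => (k i : ℝ)

/-- The obstacle `O_(k,r) = O_r + k` on the universal cover. -/
def obstacle {m N : ℕ} (O : Fin N → Set (Space m)) (a : Index m N) : Set (Space m) :=
  (fun y => y + latticePoint a.1) '' O a.2

/-- The billiard table on the universal cover: the closure of the complement of the union of
all obstacles. -/
def table {m N : ℕ} (O : Fin N → Set (Space m)) : Set (Space m) :=
  closure (⋃ a : Index m N, obstacle O a)ᶜ

/-- The obstacle with index `c`, different from those with indices `a` and `b`, is between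
these two: it meets the convex hull of their union. -/
def IsBetween {m N : ℕ} (O : Fin N → Set (Space m)) (c a b : Index m N) : Prop :=
  c ≠ a ∧ c ≠ b ∧ (convexHull ℝ (obstacle O a ∪ obstacle O b) ∩ obstacle O c).Nonempty

/-- The finite sequence `σ 0, …, σ p` of obstacles is admissible. -/
structure IsAdmissible {m N : ℕ} (O : Fin N → Set (Space m)) (p : ℕ) (σ : ℕ → Index m N) :
    Prop where
  zero : (σ 0).1 = 0
  ne_succ : ∀ n, n < p → σ (n + 1) ≠ σ n
  not_between_pair : ∀ n, n < p → ∀ c, ¬ IsBetween O c (σ n) (σ (n + 1))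
  not_between_triple : ∀ n, n + 1 < p → ¬ IsBetween O (σ (n + 1)) (σ n) (σ (n + 2))

/-- `ν` is an outer unit normal vector, at the point `x`, of the convex set `S`. -/
def IsOuterUnitNormal {m : ℕ} (S : Set (Space m)) (x ν : Space m) : Prop :=
  ‖ν‖ = 1 ∧ ∀ y ∈ S, inner ℝ (y - x) ν ≤ 0

/-- The unit vector that points from `x` to `y` (used for `x ≠ y`). -/
def direction {m : ℕ} (x y : Space m) : Space m := ‖y - x‖⁻¹ • (y - x)

/-- The law of reflection (the angle of incidence equals the angle of reflection) for a particle
that moves from `x` to the boundary point `y` of `S` and then to `z`: its velocity is reflected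
in the tangent hyperplane of `S` at `y`. -/
def IsReflected {m : ℕ} (S : Set (Space m)) (x y z : Space m) : Prop :=
  ∃ ν, IsOuterUnitNormal S y ν ∧
    direction y z = direction x y - (2 * inner ℝ (direction x y) ν) • ν

/-- The broken line with vertices `x 0, …, x p` is a piece of a billiard trajectory of type
`σ 0, …, σ p`: it starts on the boundary of `σ 0`, its consecutive reflections are from
`σ 1, …, σ (p - 1)`, it ends on the boundary of `σ p`, and it stays in the table. -/
structure IsTrajectoryPiece {m N : ℕ} (O : Fin N → Set (Space m)) (p : ℕ) (σ : ℕ → Index m N)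
    (x : ℕ → Space m) : Prop where
  mem_frontier : ∀ n, n ≤ p → x n ∈ frontier (obstacle O (σ n))
  ne_succ : ∀ n, n < p → x n ≠ x (n + 1)
  segment_subset : ∀ n, n < p → segment ℝ (x n) (x (n + 1)) ⊆ table O
  reflected : ∀ n, n + 1 < p → IsReflected (obstacle O (σ (n + 1))) (x n) (x (n + 1)) (x (n + 2))

/-- The length of the broken line with vertices `x 0, …, x p`. -/
def pieceLength {m : ℕ} (p : ℕ) (x : ℕ → Space m) : ℝ :=
  ∑ n ∈ Finset.range p, dist (x n) (x (n + 1))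

/-- The displacement of the broken line with vertices `x 0, …, x p`. -/
def displacement {m : ℕ} (p : ℕ) (x : ℕ → Space m) : Space m := x p - x 0

/-- The admissible rotation set: all limit points of sequences of quotients
displacement / length of trajectory pieces of admissible type whose lengths tend to infinity. -/
def admissibleRotationSet {m N : ℕ} (O : Fin N → Set (Space m)) : Set (Space m) :=
  {v | ∃ (p : ℕ → ℕ) (x : ℕ → ℕ → Space m),
    (∀ n, ∃ σ : ℕ → Index m N, IsAdmissible O (p n) σ ∧ IsTrajectoryPiece O (p n) σ (x n)) ∧
    Tendsto (fun n => pieceLength (p n) (x n)) atTop atTop ∧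
    MapClusterPt v atTop
      (fun n => (pieceLength (p n) (x n))⁻¹ • displacement (p n) (x n))}

end TorusBilliard

end

/-! Up to bounded errors, a trajectory piece can be replaced by its sequence of obstacles. By
compactness there is a shortest broken line through the obstacles of an admissible sequence. It is a
trajectory piece: the first-order conditions at its vertices are the law of reflection, and
admissibility keeps its segments away from the other obstacles (`IsShortest.isTrajectoryPiece`).
Conversely, a trajectory piece is at most `4 * √m` longer than any broken line through the same
obstacles (`IsTrajectoryPiece.pieceLength_le`).

Admissibility involves at most three consecutive obstacles, so two sequences can be joined along a
common edge, and shortest lengths then add up to a bounded error (`Connects.glue`). Every edge can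
be continued by at most seven bounded edges to a translate of one fixed edge, a unit lattice step
(`exists_reaches_stepEdge`). Doing this at both ends turns a trajectory piece into a loop at the
fixed edge, with bounded changes of length and displacement; every loop gives back a trajectory
piece. Loops compose: displacements add exactly and lengths up to `1 + 2 * √m`.

For a convex combination `a • v + b • w`, take long loops approximating `v` and `w`, repeat them
until their lengths are about `M * a` and `M * b`, and concatenate. Errors per repetition are a
small fraction of `M` because the basic loops are long; all other errors do not depend on `M`. -/

namespace TorusBilliard

variable {m N : ℕ} {O : Fin N → Set (Space m)}

/-! ### Lattice translations and visibility. -/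

/-- The translate of an index by a lattice vector. -/
def shift (k : Fin m → ℤ) (a : Index m N) : Index m N := (a.1 + k, a.2)

@[simp] lemma shift_fst (k : Fin m → ℤ) (a : Index m N) : (shift k a).1 = a.1 + k := rfl

@[simp] lemma shift_snd (k : Fin m → ℤ) (a : Index m N) : (shift k a).2 = a.2 := rfl

@[simp] lemma shift_zero (a : Index m N) : shift 0 a = a := by
  simp [shift]

lemma shift_shift (k l : Fin m → ℤ) (a : Index m N) :
    shift k (shift l a) = shift (l + k) a := by
  simp [shift, add_assoc]

lemma shift_injective (k : Fin m → ℤ) : Function.Injective (shift k : Index m N → Index m N) := by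
  rintro ⟨a, r⟩ ⟨b, s⟩ h
  simpa [shift] using h

@[simp] lemma latticePoint_apply (k : Fin m → ℤ) (i : Fin m) : latticePoint k i = (k i : ℝ) := rfl

@[simp] lemma latticePoint_zero : latticePoint (0 : Fin m → ℤ) = 0 := by
  ext i; simp

lemma latticePoint_add (k l : Fin m → ℤ) :
    latticePoint (k + l) = latticePoint k + latticePoint l := by
  ext i; simp

lemma latticePoint_neg (k : Fin m → ℤ) : latticePoint (-k) = -latticePoint k := by
  ext i; simp

lemma latticePoint_sub (k l : Fin m → ℤ) :
    latticePoint (k - l) = latticePoint k - latticePoint l := by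
  ext i; simp

lemma latticePoint_nsmul (n : ℕ) (k : Fin m → ℤ) :
    latticePoint (n • k) = (n : ℝ) • latticePoint k := by
  ext i; simp

lemma mem_obstacle {a : Index m N} {x : Space m} :
    x ∈ obstacle O a ↔ x - latticePoint a.1 ∈ O a.2 := by
  constructor
  · rintro ⟨y, hy, rfl⟩
    simpa using hy
  · intro h
    exact ⟨_, h, by simp⟩

lemma mem_obstacle_shift {k : Fin m → ℤ} {a : Index m N} {x : Space m} :
    x ∈ obstacle O (shift k a) ↔ x - latticePoint k ∈ obstacle O a := by
  rw [mem_obstacle, mem_obstacle]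
  simp [latticePoint_add, sub_sub, add_comm]

lemma obstacle_shift (k : Fin m → ℤ) (a : Index m N) :
    obstacle O (shift k a) = (fun y => y + latticePoint k) '' obstacle O a := by
  ext x
  rw [mem_obstacle_shift]
  constructor
  · intro h
    exact ⟨_, h, by simp⟩
  · rintro ⟨y, hy, rfl⟩
    simpa using hy

lemma convexHull_image_add (S : Set (Space m)) (v : Space m) :
    convexHull ℝ ((fun y => y + v) '' S) = (fun y => y + v) '' convexHull ℝ S := by
  have h := convexHull_vadd (𝕜 := ℝ) v S
  simpa [← Set.image_vadd, add_comm] using h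

lemma isBetween_shift {k : Fin m → ℤ} {a b c : Index m N} :
    IsBetween O (shift k c) (shift k a) (shift k b) ↔ IsBetween O c a b := by
  unfold IsBetween
  rw [(shift_injective k).ne_iff, (shift_injective k).ne_iff, obstacle_shift, obstacle_shift,
    obstacle_shift, ← image_union, convexHull_image_add,
    ← image_inter (add_left_injective (latticePoint k)), image_nonempty]

lemma isBetween_comm {a b c : Index m N} : IsBetween O c a b ↔ IsBetween O c b a := by
  unfold IsBetween
  rw [union_comm]
  tauto

/-- Two different obstacles with no obstacle between them. -/
def Visible (O : Fin N → Set (Space m)) (a b : Index m N) : Prop :=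
  b ≠ a ∧ ∀ c, ¬ IsBetween O c a b

lemma Visible.symm {a b : Index m N} (h : Visible O a b) : Visible O b a :=
  ⟨h.1.symm, fun c hc => h.2 c (isBetween_comm.1 hc)⟩

lemma visible_shift {k : Fin m → ℤ} {a b : Index m N} :
    Visible O (shift k a) (shift k b) ↔ Visible O a b := by
  unfold Visible
  rw [(shift_injective k).ne_iff]
  refine and_congr_right fun _ => ⟨fun h c hc => h (shift k c) (isBetween_shift.2 hc), ?_⟩
  intro h c hc
  have : c = shift k (shift (-k) c) := by simp [shift_shift]
  rw [this, isBetween_shift] at hc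
  exact h _ hc

/-! ### Separation of obstacles by half-spaces and coordinates. -/

lemma not_mem_convexHull_of_inner_lt {S : Set (Space m)} {y g : Space m}
    (h : ∀ x ∈ S, inner ℝ g y < inner ℝ g x) : y ∉ convexHull ℝ S := by
  intro hy
  have hc : Convex ℝ {x : Space m | inner ℝ g y < inner ℝ g x} :=
    convex_halfSpace_gt (innerSL ℝ g).isLinear _
  exact lt_irrefl (inner ℝ g y) (convexHull_min (fun x hx => h x hx) hc hy)

lemma not_mem_convexHull_of_coord_lt {S : Set (Space m)} {y : Space m} (i : Fin m)
    (h : ∀ x ∈ S, y i < x i) : y ∉ convexHull ℝ S :=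
  not_mem_convexHull_of_inner_lt (g := EuclideanSpace.single i 1) fun x hx => by
    simpa [EuclideanSpace.inner_single_left] using h x hx

lemma not_mem_convexHull_of_lt_coord {S : Set (Space m)} {y : Space m} (i : Fin m)
    (h : ∀ x ∈ S, x i < y i) : y ∉ convexHull ℝ S :=
  not_mem_convexHull_of_inner_lt (g := EuclideanSpace.single i (-1)) fun x hx => by
    simpa [EuclideanSpace.inner_single_left] using h x hx

namespace IsObstacleFamily

variable (hO : IsObstacleFamily O)
include hO

lemma coord_mem {a : Index m N} {x : Space m} (hx : x ∈ obstacle O a) (i : Fin m) :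
    (a.1 i : ℝ) < x i ∧ x i < a.1 i + 1 := by
  have := hO.subset_cube _ _ (mem_obstacle.1 hx) i
  simp only [PiLp.sub_apply, latticePoint_apply, mem_Ioo] at this
  constructor <;> linarith

lemma disjoint_obstacle {a b : Index m N} (hab : a ≠ b) :
    Disjoint (obstacle O a) (obstacle O b) := by
  rw [Set.disjoint_left]
  intro x hxa hxb
  have h1 : a.1 = b.1 := by
    funext i
    have h1 := hO.coord_mem hxa i
    have h2 := hO.coord_mem hxb i
    have h3 : (a.1 i : ℝ) < b.1 i + 1 := by linarith
    have h4 : (b.1 i : ℝ) < a.1 i + 1 := by linarith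
    have h5 : a.1 i < b.1 i + 1 := by exact_mod_cast h3
    have h6 : b.1 i < a.1 i + 1 := by exact_mod_cast h4
    omega
  have h2 : a.2 ≠ b.2 := fun h => hab (Prod.ext h1 h)
  rw [mem_obstacle] at hxa hxb
  rw [h1] at hxa
  exact Set.disjoint_left.1 (hO.disjoint _ _ h2) hxa hxb

lemma isCompact_obstacle (a : Index m N) : IsCompact (obstacle O a) :=
  (hO.isCompact a.2).image (by fun_prop)

lemma convex_obstacle (a : Index m N) : Convex ℝ (obstacle O a) := by
  have := (hO.strictConvex a.2).convex.translate (latticePoint a.1)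
  simpa only [obstacle, add_comm] using this

lemma nonempty_obstacle (a : Index m N) : (obstacle O a).Nonempty :=
  ((hO.interior_nonempty a.2).mono interior_subset).image _

/-- The `i`-th coordinates of the convex set `O r - O s` form an interval. If they took both signs,
they would include `0`, against the disjointness of the projections. -/
lemma coord_separated (i : Fin m) {r s : Fin N} (hrs : r ≠ s) :
    (∀ x ∈ O r, ∀ y ∈ O s, x i < y i) ∨ ∀ x ∈ O r, ∀ y ∈ O s, y i < x i := by
  by_contra! h
  obtain ⟨⟨x, hx, y, hy, h1⟩, x', hx', y', hy', h2⟩ := h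
  have hlin : IsLinearMap ℝ fun x : Space m => x i := ⟨fun _ _ => rfl, fun _ _ => rfl⟩
  have hconv := (((hO.strictConvex r).convex.sub (hO.strictConvex s).convex).is_linear_image
    hlin).ordConnected
  obtain ⟨z, hz, hz0⟩ := hconv.out (mem_image_of_mem _ (sub_mem_sub hx' hy'))
    (mem_image_of_mem _ (sub_mem_sub hx hy)) (show (0 : ℝ) ∈ _ by simp [h1, h2])
  obtain ⟨a, ha, b, hb, rfl⟩ := hz
  refine Set.disjoint_left.1 (hO.disjoint_proj i r s hrs) (mem_image_of_mem _ ha) ⟨b, hb, ?_⟩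
  simp only [PiLp.sub_apply] at hz0
  simp only
  linarith

lemma exists_coord_separated [NeZero m] {a b : Index m N} (hab : a ≠ b) :
    ∃ i, (∀ x ∈ obstacle O a, ∀ y ∈ obstacle O b, x i < y i) ∨
      ∀ x ∈ obstacle O a, ∀ y ∈ obstacle O b, y i < x i := by
  by_cases h : a.1 = b.1
  · have h2 : a.2 ≠ b.2 := fun h' => hab (Prod.ext h h')
    refine ⟨0, (hO.coord_separated 0 h2).imp ?_ ?_⟩ <;>
    · intro H x hx y hy
      have := H _ (mem_obstacle.1 hx) _ (mem_obstacle.1 hy)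
      simpa [h] using this
  · obtain ⟨i, hi⟩ := Function.ne_iff.1 h
    have key : ∀ c d : Index m N, c.1 i < d.1 i →
        ∀ x ∈ obstacle O c, ∀ y ∈ obstacle O d, x i < y i := by
      intro c d H x hx y hy
      have h1 := hO.coord_mem hx i
      have h2 := hO.coord_mem hy i
      have h3 : (c.1 i : ℝ) + 1 ≤ d.1 i := by exact_mod_cast H
      linarith
    exact ⟨i, (lt_or_gt_of_ne hi).imp (key a b) fun H x hx y hy => key b a H y hy x hx⟩

end IsObstacleFamily

/-! ### Unit lattice steps and admissible continuations. -/

/-- A lattice vector of length one. -/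
def IsStep (u : Fin m → ℤ) : Prop := ∃ i, u = Pi.single i 1 ∨ u = -Pi.single i 1

lemma isStep_single (i : Fin m) : IsStep (Pi.single i 1 : Fin m → ℤ) := ⟨i, Or.inl rfl⟩

lemma IsStep.neg {u : Fin m → ℤ} (hu : IsStep u) : IsStep (-u) := by
  obtain ⟨i, rfl | rfl⟩ := hu
  · exact ⟨i, Or.inr rfl⟩
  · exact ⟨i, Or.inl (neg_neg _)⟩

lemma IsStep.dotProduct_self {u : Fin m → ℤ} (hu : IsStep u) : u ⬝ᵥ u = 1 := by
  obtain ⟨i, rfl | rfl⟩ := hu <;> simp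

lemma IsStep.ne_zero {u : Fin m → ℤ} (hu : IsStep u) : u ≠ 0 := by
  rintro rfl
  simpa using hu.dotProduct_self

lemma IsStep.dotProduct_nonpos {u w : Fin m → ℤ} (hu : IsStep u) (hw : IsStep w) (h : u ≠ w) :
    u ⬝ᵥ w ≤ 0 := by
  obtain ⟨i, rfl | rfl⟩ := hu <;> obtain ⟨j, rfl | rfl⟩ := hw <;>
    rcases eq_or_ne i j with rfl | hij <;> simp_all

lemma inner_latticePoint (u w : Fin m → ℤ) :
    inner ℝ (latticePoint u) (latticePoint w) = ((u ⬝ᵥ w : ℤ) : ℝ) := by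
  simp [PiLp.inner_apply, dotProduct, mul_comm]

lemma IsStep.norm_latticePoint {u : Fin m → ℤ} (hu : IsStep u) : ‖latticePoint u‖ = 1 := by
  have := real_inner_self_eq_norm_sq (latticePoint u)
  rw [inner_latticePoint, hu.dotProduct_self] at this
  push_cast at this
  nlinarith [norm_nonneg (latticePoint u)]

namespace IsObstacleFamily

variable (hO : IsObstacleFamily O)
include hO

/-- From any obstacle `b` one can continue by some unit step. -/
lemma exists_step_not_isBetween [NeZero m] {a b : Index m N} (hab : a ≠ b) :
    ∃ u, IsStep u ∧ ¬ IsBetween O b a (shift u b) := by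
  -- Turn back in a coordinate that separates `a` from `b`: the next obstacle then lies on the same
  -- side of `b` as `a`.
  obtain ⟨i, h | h⟩ := hO.exists_coord_separated hab
  · refine ⟨-Pi.single i 1, (isStep_single i).neg, ?_⟩
    rintro ⟨-, -, y, hy, hyb⟩
    refine not_mem_convexHull_of_lt_coord i ?_ hy
    rintro x (hx | hx)
    · exact h x hx y hyb
    · have h1 := hO.coord_mem hx i
      have h2 := hO.coord_mem hyb i
      simp at h1
      linarith
  · refine ⟨Pi.single i 1, isStep_single i, ?_⟩
    rintro ⟨-, -, y, hy, hyb⟩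
    refine not_mem_convexHull_of_coord_lt i ?_ hy
    rintro x (hx | hx)
    · exact h x hx y hyb
    · have h1 := hO.coord_mem hx i
      have h2 := hO.coord_mem hyb i
      simp at h1
      linarith

/-- Two different unit steps can follow each other. -/
lemma not_isBetween_step_step {u w : Fin m → ℤ} (hu : IsStep u) (hw : IsStep w) (h : u ≠ w)
    (b : Index m N) : ¬ IsBetween O b (shift (-u) b) (shift w b) := by
  rintro ⟨-, -, y, hy, hyb⟩
  -- Both translations, by `-u` and by `w`, raise the functional `w - u` by `1 - u ⬝ᵥ w ≥ 1`. Within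
  -- the obstacle it varies by less: its norm squared is `2 * (1 - u ⬝ᵥ w)` and the diameter is
  -- below `1 / 2`.
  refine not_mem_convexHull_of_inner_lt (g := latticePoint (w - u)) ?_ hy
  have hd := hu.dotProduct_nonpos hw h
  have key : ∀ x ∈ obstacle O b,
      |inner ℝ (latticePoint (w - u)) (x - y)| < ((1 - u ⬝ᵥ w : ℤ) : ℝ) := by
    intro x hx
    have h1 : ‖x - y‖ < 1 / 2 := by
      have h2 := Metric.dist_le_diam_of_mem (hO.isCompact b.2).isBounded
        (mem_obstacle.1 hx) (mem_obstacle.1 hyb)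
      rw [dist_sub_right, dist_eq_norm] at h2
      have h3 := hO.diam_lt b.2
      have h4 : Real.sqrt 2 < 2 := by
        rw [Real.sqrt_lt' (by norm_num)]
        norm_num
      linarith
    have h2 : ‖latticePoint (w - u)‖ ^ 2 = 2 * ((1 - u ⬝ᵥ w : ℤ) : ℝ) := by
      rw [← real_inner_self_eq_norm_sq, inner_latticePoint]
      have : (w - u) ⬝ᵥ (w - u) = 2 * (1 - u ⬝ᵥ w) := by
        rw [sub_dotProduct, dotProduct_sub, dotProduct_sub, hu.dotProduct_self,
          hw.dotProduct_self, dotProduct_comm w u]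
        ring
      rw [this]
      push_cast
      ring
    have h3 : (1 : ℝ) ≤ ((1 - u ⬝ᵥ w : ℤ) : ℝ) := by
      exact_mod_cast (by omega : (1 : ℤ) ≤ 1 - u ⬝ᵥ w)
    refine lt_of_le_of_lt (abs_real_inner_le_norm _ _) ?_
    set s : ℝ := ((1 - u ⬝ᵥ w : ℤ) : ℝ)
    have h4 := norm_nonneg (latticePoint (w - u))
    have h5 := norm_nonneg (x - y)
    have h6 : ‖latticePoint (w - u)‖ < 2 * s := by nlinarith
    nlinarith
  rintro x (hx | hx) <;> rw [mem_obstacle_shift] at hx <;> have h1 := (abs_lt.1 (key _ hx)).1 <;>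
    rw [sub_sub, inner_sub_right, inner_add_right, inner_latticePoint, sub_dotProduct] at h1
  · rw [dotProduct_neg, dotProduct_neg, hu.dotProduct_self, dotProduct_comm w u] at h1
    push_cast at h1
    linarith
  · rw [hw.dotProduct_self] at h1
    push_cast at h1
    linarith

/-- In the coordinates `j ≠ i` the hull has the same projections as obstacle `a`. An obstacle
meeting it therefore lies in the same column of cubes, and has the number of `a` because projections
of different obstacles are disjoint; here a second coordinate is needed. Its other copies in the
column are separated from the hull by coordinate `i`. -/
lemma visible_single (hm : 2 ≤ m) (i : Fin m) (a : Index m N) :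
    Visible O a (shift (Pi.single i 1) a) := by
  refine ⟨fun h => (isStep_single i).ne_zero ?_, ?_⟩
  · simpa only [shift, Prod.ext_iff, add_eq_left, and_true] using h
  rintro c ⟨hca, hcb, y, hy, hyc⟩
  have hj : ∀ j ≠ i, ∃ x ∈ obstacle O a, x j = y j := by
    intro j hji
    have hlin : IsLinearMap ℝ fun x : Space m => x j := ⟨fun _ _ => rfl, fun _ _ => rfl⟩
    have hconv := ((hO.convex_obstacle a).is_linear_image hlin).is_linear_preimage hlin
    refine convexHull_min ?_ hconv hy
    rintro x (hx | hx)
    · exact ⟨x, hx, rfl⟩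
    · exact ⟨_, mem_obstacle_shift.1 hx, by simp [hji]⟩
  have hcj : ∀ j ≠ i, c.1 j = a.1 j := by
    intro j hji
    obtain ⟨x, hx, hxy⟩ := hj j hji
    have h1 := hO.coord_mem hx j
    have h2 := hO.coord_mem hyc j
    have h3 : (a.1 j : ℝ) < c.1 j + 1 := by linarith
    have h4 : (c.1 j : ℝ) < a.1 j + 1 := by linarith
    have h5 : a.1 j < c.1 j + 1 := by exact_mod_cast h3
    have h6 : c.1 j < a.1 j + 1 := by exact_mod_cast h4
    omega
  by_cases hr : c.2 = a.2
  · have hi0 : c.1 i ≠ a.1 i := by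
      intro h
      refine hca (Prod.ext ?_ hr)
      funext j
      rcases eq_or_ne j i with rfl | hji
      exacts [h, hcj j hji]
    have hi1 : c.1 i ≠ a.1 i + 1 := by
      intro h
      refine hcb (Prod.ext ?_ hr)
      funext j
      rcases eq_or_ne j i with rfl | hji
      · simp [h]
      · simp [hji, hcj j hji]
    have h2 := hO.coord_mem hyc i
    rcases (by omega : c.1 i + 1 ≤ a.1 i ∨ a.1 i + 2 ≤ c.1 i) with h | h
    · have h' : (c.1 i : ℝ) + 1 ≤ a.1 i := by exact_mod_cast h
      refine not_mem_convexHull_of_coord_lt i ?_ hy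
      rintro x (hx | hx) <;> have h1 := hO.coord_mem hx i <;> simp at h1 <;> linarith
    · have h' : (a.1 i : ℝ) + 2 ≤ c.1 i := by exact_mod_cast h
      refine not_mem_convexHull_of_lt_coord i ?_ hy
      rintro x (hx | hx) <;> have h1 := hO.coord_mem hx i <;> simp at h1 <;> linarith
  · have : Nontrivial (Fin m) := Fin.nontrivial_iff_two_le.2 hm
    obtain ⟨j, hji⟩ := exists_ne i
    obtain ⟨x, hx, hxy⟩ := hj j hji
    refine Set.disjoint_left.1 (hO.disjoint_proj j _ _ hr) ⟨_, mem_obstacle.1 hyc, rfl⟩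
      ⟨_, mem_obstacle.1 hx, ?_⟩
    simp [hxy, hcj j hji]

lemma visible_step (hm : 2 ≤ m) {u : Fin m → ℤ} (hu : IsStep u) (a : Index m N) :
    Visible O a (shift u a) := by
  obtain ⟨i, rfl | rfl⟩ := hu
  · exact hO.visible_single hm i a
  · have := (hO.visible_single hm i (shift (-Pi.single i 1) a)).symm
    simpa [shift_shift] using this

/-- The hull stays in the open cube of the two obstacles, so a third obstacle meeting it lies in
that cube too, which no eclipse forbids. -/
lemma visible_of_fst_eq {a b : Index m N} (h : a.1 = b.1) (hr : a.2 ≠ b.2) : Visible O a b := by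
  refine ⟨fun h => hr (h ▸ rfl), ?_⟩
  rintro c ⟨hca, hcb, y, hy, hyc⟩
  have hc : c.1 = a.1 := by
    by_contra hne
    obtain ⟨i, hi⟩ := Function.ne_iff.1 hne
    have h2 := hO.coord_mem hyc i
    rcases (by omega : c.1 i + 1 ≤ a.1 i ∨ a.1 i + 1 ≤ c.1 i) with h' | h'
    · have h3 : (c.1 i : ℝ) + 1 ≤ a.1 i := by exact_mod_cast h'
      refine not_mem_convexHull_of_coord_lt i ?_ hy
      rintro x (hx | hx) <;> have h1 := hO.coord_mem hx i <;> try rw [← h] at h1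
      all_goals linarith
    · have h3 : (a.1 i : ℝ) + 1 ≤ c.1 i := by exact_mod_cast h'
      refine not_mem_convexHull_of_lt_coord i ?_ hy
      rintro x (hx | hx) <;> have h1 := hO.coord_mem hx i <;> try rw [← h] at h1
      all_goals linarith
  have hca' : c.2 ≠ a.2 := fun h' => hca (Prod.ext hc h')
  have hcb' : c.2 ≠ b.2 := fun h' => hcb (Prod.ext (hc.trans h) h')
  refine Set.disjoint_left.1 (hO.no_eclipse _ _ _ hr hca' hcb') ?_ (mem_obstacle.1 hyc)
  rw [obstacle, obstacle, ← h, ← image_union, convexHull_image_add] at hy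
  obtain ⟨z, hz, rfl⟩ := hy
  simpa [hc] using hz

end IsObstacleFamily

/-! ### First-order conditions and the law of reflection. -/

/-- The linear term is the first variation of the norm. The explicit quadratic remainder, from the
inequality of arithmetic and geometric means, replaces differentiation in the minimum conditions
below. -/
lemma norm_add_smul_le {v : Space m} (hv : v ≠ 0) (w : Space m) (t : ℝ) :
    ‖v + t • w‖ ≤ ‖v‖ + t * inner ℝ (‖v‖⁻¹ • v) w + t ^ 2 * (‖w‖ ^ 2 / (2 * ‖v‖)) := by
  have hv' : 0 < ‖v‖ := norm_pos_iff.2 hv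
  have h1 : ‖v + t • w‖ ^ 2 = ‖v‖ ^ 2 + 2 * (t * inner ℝ v w) + t ^ 2 * ‖w‖ ^ 2 := by
    rw [norm_add_sq_real, real_inner_smul_right, norm_smul, mul_pow, Real.norm_eq_abs, sq_abs]
  have h2 : ‖v‖ * ‖v + t • w‖ ≤ ‖v‖ ^ 2 + t * inner ℝ v w + t ^ 2 * ‖w‖ ^ 2 / 2 := by
    nlinarith [sq_nonneg (‖v‖ - ‖v + t • w‖)]
  rw [real_inner_smul_left]
  have h3 : ‖v‖ + t * (‖v‖⁻¹ * inner ℝ v w) + t ^ 2 * (‖w‖ ^ 2 / (2 * ‖v‖)) =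
      (‖v‖ ^ 2 + t * inner ℝ v w + t ^ 2 * ‖w‖ ^ 2 / 2) / ‖v‖ := by
    field_simp
  rw [h3, le_div_iff₀ hv']
  linarith

lemma nonneg_of_forall_add_sq {g C : ℝ} (h : ∀ t : ℝ, 0 < t → t ≤ 1 → 0 ≤ t * g + t ^ 2 * C) :
    0 ≤ g := by
  by_contra! hg
  set t : ℝ := min 1 (-g / (2 * (|C| + 1))) with ht
  have hC : 0 < 2 * (|C| + 1) := by positivity
  have ht0 : 0 < t := lt_min one_pos (div_pos (neg_pos.2 hg) hC)
  have h1 := h t ht0 (min_le_left _ _)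
  have h2 : t * (2 * (|C| + 1)) ≤ -g := (le_div_iff₀ hC).1 (min_le_right _ _)
  have h3 : 0 ≤ g + t * C := by
    by_contra! h4
    nlinarith
  nlinarith [le_abs_self C]

lemma norm_direction {x y : Space m} (h : x ≠ y) : ‖direction x y‖ = 1 := by
  have : ‖y - x‖ ≠ 0 := norm_ne_zero_iff.2 (sub_ne_zero.2 h.symm)
  rw [direction, norm_smul, norm_inv, norm_norm, inv_mul_cancel₀ this]

lemma dist_smul_direction {x y : Space m} (h : x ≠ y) : dist x y • direction x y = y - x := by
  have : ‖y - x‖ ≠ 0 := norm_ne_zero_iff.2 (sub_ne_zero.2 h.symm)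
  rw [direction, dist_comm, dist_eq_norm, smul_inv_smul₀ this]

lemma inner_direction {x y : Space m} (h : x ≠ y) : inner ℝ (direction x y) (y - x) = dist x y := by
  rw [← dist_smul_direction h, real_inner_smul_right, real_inner_self_eq_norm_sq,
    norm_direction h]
  ring

lemma direction_comm (x y : Space m) : direction y x = -direction x y := by
  rw [direction, direction, ← smul_neg, neg_sub, norm_sub_rev]

/-- First order condition for a minimum of the distance to a point. -/
lemma inner_direction_nonneg_of_min {S : Set (Space m)} (hS : Convex ℝ S) {a y : Space m}
    (hy : y ∈ S) (hay : a ≠ y) (hmin : ∀ z ∈ S, dist a y ≤ dist a z) {z : Space m} (hz : z ∈ S) :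
    0 ≤ inner ℝ (direction a y) (z - y) := by
  refine nonneg_of_forall_add_sq (C := ‖z - y‖ ^ 2 / (2 * ‖y - a‖)) fun t ht0 ht1 => ?_
  have h1 := hmin (y + t • (z - y)) (hS.add_smul_sub_mem hy hz ⟨ht0.le, ht1⟩)
  have h2 := norm_add_smul_le (sub_ne_zero.2 hay.symm) (z - y) t
  rw [dist_comm a, dist_comm a, dist_eq_norm, dist_eq_norm, add_sub_right_comm] at h1
  rw [direction]
  linarith

/-- First order condition for a minimum of the sum of the distances to two points. -/
lemma inner_direction_sub_nonneg_of_min {S : Set (Space m)} (hS : Convex ℝ S) {a b y : Space m}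
    (hy : y ∈ S) (hay : a ≠ y) (hyb : y ≠ b)
    (hmin : ∀ z ∈ S, dist a y + dist y b ≤ dist a z + dist z b) {z : Space m} (hz : z ∈ S) :
    0 ≤ inner ℝ (direction a y - direction y b) (z - y) := by
  refine nonneg_of_forall_add_sq
    (C := ‖z - y‖ ^ 2 / (2 * ‖y - a‖) + ‖z - y‖ ^ 2 / (2 * ‖y - b‖)) fun t ht0 ht1 => ?_
  have h1 := hmin (y + t • (z - y)) (hS.add_smul_sub_mem hy hz ⟨ht0.le, ht1⟩)
  have h2 := norm_add_smul_le (sub_ne_zero.2 hay.symm) (z - y) t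
  have h3 := norm_add_smul_le (sub_ne_zero.2 hyb) (z - y) t
  rw [dist_comm a, dist_comm a, dist_eq_norm, dist_eq_norm, dist_eq_norm, dist_eq_norm,
    add_sub_right_comm, add_sub_right_comm] at h1
  rw [direction_comm b y, sub_neg_eq_add, inner_add_left, direction, direction]
  linarith

lemma mem_frontier_of_inner_nonneg {S : Set (Space m)} {y g : Space m} (hy : y ∈ S) (hg : g ≠ 0)
    (h : ∀ z ∈ S, 0 ≤ inner ℝ g (z - y)) : y ∈ frontier S := by
  refine ⟨subset_closure hy, fun hi => ?_⟩
  have hc : Tendsto (fun t : ℝ => y - t • g) (𝓝[>] 0) (𝓝 y) := by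
    have : Continuous fun t : ℝ => y - t • g := by fun_prop
    simpa using (this.tendsto 0).mono_left nhdsWithin_le_nhds
  obtain ⟨t, ht, ht0⟩ := ((hc.eventually (isOpen_interior.mem_nhds hi)).and
    self_mem_nhdsWithin).exists
  have h1 := h _ (interior_subset ht)
  rw [sub_sub_cancel_left, inner_neg_right, real_inner_smul_right, real_inner_self_eq_norm_sq] at h1
  have : 0 < t * ‖g‖ ^ 2 := mul_pos ht0 (by positivity)
  linarith

lemma mem_segment_of_direction_eq {a y b : Space m} (hay : a ≠ y) (hyb : y ≠ b)
    (h : direction a y = direction y b) : y ∈ segment ℝ a b := by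
  rw [mem_segment_iff_sameRay, ← dist_smul_direction hay, ← dist_smul_direction hyb, h]
  exact (SameRay.sameRay_nonneg_smul_right _ dist_nonneg).nonneg_smul_left dist_nonneg

/-- The difference `g` of the two directions points into `S`, so `-g / ‖g‖` is the outer normal. As
both directions are unit vectors, `2 * ⟪direction a y, g⟫ = ‖g‖ ^ 2`, so reflection subtracts
exactly `g`. -/
lemma isReflected_of_inner_nonneg {S : Set (Space m)} {a y b : Space m} (hay : a ≠ y) (hyb : y ≠ b)
    (hne : direction a y ≠ direction y b)
    (h : ∀ z ∈ S, 0 ≤ inner ℝ (direction a y - direction y b) (z - y)) :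
    IsReflected S a y b := by
  set g := direction a y - direction y b with hg
  have hg0 : ‖g‖ ≠ 0 := norm_ne_zero_iff.2 (sub_ne_zero.2 hne)
  have h1 : 2 * inner ℝ (direction a y) g = ‖g‖ ^ 2 := by
    rw [hg, norm_sub_sq_real, inner_sub_right, real_inner_self_eq_norm_sq, norm_direction hay,
      norm_direction hyb]
    ring
  refine ⟨-(‖g‖⁻¹ • g), ⟨by rw [norm_neg, norm_smul, norm_inv, norm_norm, inv_mul_cancel₀ hg0],
    fun z hz => ?_⟩, ?_⟩
  · rw [inner_neg_right, real_inner_smul_right, real_inner_comm]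
    have := mul_nonneg (inv_nonneg.2 (norm_nonneg g)) (h z hz)
    linarith
  · have h2 : (2 * inner ℝ (direction a y) (-(‖g‖⁻¹ • g))) • -(‖g‖⁻¹ • g) = g := by
      rw [inner_neg_right, real_inner_smul_right, smul_neg, smul_smul]
      have : 2 * -(‖g‖⁻¹ * inner ℝ (direction a y) g) * ‖g‖⁻¹ = -1 := by
        field_simp
        linarith
      rw [this]
      simp
    rw [h2, hg, sub_sub_cancel]

/-! ### Shortest broken lines are trajectory pieces. -/

/-- A chain of obstacles that satisfies the conditions of admissibility, without
normalization of its beginning. -/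
structure IsWalk (O : Fin N → Set (Space m)) (p : ℕ) (σ : ℕ → Index m N) : Prop where
  visible : ∀ n, n < p → Visible O (σ n) (σ (n + 1))
  turn : ∀ n, n + 1 < p → ¬ IsBetween O (σ (n + 1)) (σ n) (σ (n + 2))

lemma IsAdmissible.isWalk {p : ℕ} {σ : ℕ → Index m N} (h : IsAdmissible O p σ) : IsWalk O p σ :=
  ⟨fun n hn => ⟨h.ne_succ n hn, h.not_between_pair n hn⟩, h.not_between_triple⟩

lemma IsWalk.isAdmissible {p : ℕ} {σ : ℕ → Index m N} (h : IsWalk O p σ) (h0 : (σ 0).1 = 0) :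
    IsAdmissible O p σ :=
  ⟨h0, fun n hn => (h.visible n hn).1, fun n hn => (h.visible n hn).2, h.turn⟩

/-- The vertices `x n` lie in the obstacles `σ n`, and the broken line `x 0, …, x p` is a shortest
one with this property. -/
structure IsShortest (O : Fin N → Set (Space m)) (p : ℕ) (σ : ℕ → Index m N)
    (x : ℕ → Space m) : Prop where
  mem : ∀ n, x n ∈ obstacle O (σ n)
  le : ∀ y : ℕ → Space m, (∀ n, n ≤ p → y n ∈ obstacle O (σ n)) → pieceLength p x ≤ pieceLength p y

lemma pieceLength_congr {p : ℕ} {x y : ℕ → Space m} (h : ∀ n, n ≤ p → x n = y n) :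
    pieceLength p x = pieceLength p y := by
  refine Finset.sum_congr rfl fun n hn => ?_
  rw [Finset.mem_range] at hn
  rw [h n hn.le, h (n + 1) hn]

lemma pieceLength_add (p q : ℕ) (x : ℕ → Space m) :
    pieceLength (p + q) x = pieceLength p x + pieceLength q (fun n => x (p + n)) := by
  simp [pieceLength, Finset.sum_range_add, add_assoc]

lemma pieceLength_one (x : ℕ → Space m) : pieceLength 1 x = dist (x 0) (x 1) := by
  simp [pieceLength]

lemma pieceLength_nonneg (p : ℕ) (x : ℕ → Space m) : 0 ≤ pieceLength p x :=
  Finset.sum_nonneg fun _ _ => dist_nonneg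

namespace IsObstacleFamily

variable (hO : IsObstacleFamily O)
include hO

lemma exists_mem_forall {p : ℕ} {σ : ℕ → Index m N} {y : ℕ → Space m}
    (hy : ∀ n, n ≤ p → y n ∈ obstacle O (σ n)) :
    ∃ z : ℕ → Space m, (∀ n, z n ∈ obstacle O (σ n)) ∧ ∀ n, n ≤ p → z n = y n := by
  choose c hc using fun n => hO.nonempty_obstacle (σ n)
  refine ⟨fun n => if n ≤ p then y n else c n, fun n => ?_, fun n hn => if_pos hn⟩
  by_cases h : n ≤ p
  · simpa [h] using hy n h
  · simpa [h] using hc n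

/-- The infinite product of the obstacles is compact; vertices after `p` are arbitrary and do not
affect the length. -/
lemma exists_isShortest (p : ℕ) (σ : ℕ → Index m N) : ∃ x, IsShortest O p σ x := by
  have hK : IsCompact (Set.pi univ fun n => obstacle O (σ n)) :=
    isCompact_univ_pi fun n => hO.isCompact_obstacle (σ n)
  have hne : (Set.pi univ fun n => obstacle O (σ n)).Nonempty :=
    univ_pi_nonempty_iff.2 fun n => hO.nonempty_obstacle (σ n)
  have hcont : Continuous fun x : ℕ → Space m => pieceLength p x := by
    unfold pieceLength
    fun_prop
  obtain ⟨x, hx, hmin⟩ := hK.exists_isMinOn hne hcont.continuousOn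
  refine ⟨x, fun n => hx n (mem_univ n), fun y hy => ?_⟩
  obtain ⟨z, hz, hzy⟩ := hO.exists_mem_forall hy
  rw [← pieceLength_congr hzy]
  exact hmin fun n _ => hz n

end IsObstacleFamily

lemma pieceLength_two (x : ℕ → Space m) :
    pieceLength 2 x = dist (x 0) (x 1) + dist (x 1) (x 2) := by
  simp [pieceLength, Finset.sum_range_succ]

namespace IsShortest

variable {p : ℕ} {σ : ℕ → Index m N} {x : ℕ → Space m}

lemma pieceLength_le_update (hx : IsShortest O p σ x) (n : ℕ) {z : Space m}
    (hz : z ∈ obstacle O (σ n)) : pieceLength p x ≤ pieceLength p (Function.update x n z) := by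
  refine hx.le _ fun k _ => ?_
  rcases eq_or_ne k n with rfl | hk
  · simpa using hz
  · simpa [hk] using hx.mem k

lemma dist_add_dist_le (hx : IsShortest O p σ x) {n : ℕ} (hn : n + 1 < p) {z : Space m}
    (hz : z ∈ obstacle O (σ (n + 1))) :
    dist (x n) (x (n + 1)) + dist (x (n + 1)) (x (n + 2)) ≤ dist (x n) z + dist z (x (n + 2)) := by
  obtain ⟨q, rfl⟩ := Nat.exists_eq_add_of_le (show n + 2 ≤ p from hn)
  have h := hx.pieceLength_le_update (n + 1) hz
  rw [pieceLength_add, pieceLength_add, pieceLength_add, pieceLength_add, pieceLength_two,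
    pieceLength_two,
    pieceLength_congr (p := n) (x := Function.update x (n + 1) z) (y := x)
      (fun k hk => Function.update_of_ne (by omega) _ _),
    pieceLength_congr (p := q) (x := fun k => Function.update x (n + 1) z (n + 2 + k))
      (y := fun k => x (n + 2 + k))
      (fun k hk => Function.update_of_ne (by omega) _ _)] at h
  simp at h
  linarith

lemma dist_first_le (hx : IsShortest O p σ x) (hp : 0 < p) {z : Space m}
    (hz : z ∈ obstacle O (σ 0)) : dist (x 1) (x 0) ≤ dist (x 1) z := by
  obtain ⟨q, rfl⟩ := Nat.exists_eq_add_of_le (show 1 ≤ p from hp)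
  have h := hx.pieceLength_le_update 0 hz
  rw [pieceLength_add, pieceLength_add, pieceLength_one, pieceLength_one,
    pieceLength_congr (p := q) (x := fun k => Function.update x 0 z (1 + k))
      (y := fun k => x (1 + k))
      (fun k hk => Function.update_of_ne (by omega) _ _)] at h
  simp at h
  rwa [dist_comm, dist_comm _ z]

lemma dist_last_le (hx : IsShortest O (p + 1) σ x) {z : Space m}
    (hz : z ∈ obstacle O (σ (p + 1))) : dist (x p) (x (p + 1)) ≤ dist (x p) z := by
  have h := hx.pieceLength_le_update (p + 1) hz
  rw [pieceLength_add, pieceLength_add, pieceLength_one, pieceLength_one,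
    pieceLength_congr (p := p) (x := Function.update x (p + 1) z) (y := x)
      (fun k hk => Function.update_of_ne (by omega) _ _)] at h
  simpa using h

lemma ne_succ (hO : IsObstacleFamily O) (hσ : IsWalk O p σ) (hx : IsShortest O p σ x) {n : ℕ}
    (hn : n < p) : x n ≠ x (n + 1) := fun h =>
  Set.disjoint_left.1 (hO.disjoint_obstacle (hσ.visible n hn).1) (hx.mem (n + 1))
    (h ▸ hx.mem n)

/-- If the line went straight through `x (n + 1)`, this vertex would lie on the segment from `x n`
to `x (n + 2)`, and its obstacle would be between the neighbouring ones. -/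
lemma direction_ne (hO : IsObstacleFamily O) (hσ : IsWalk O p σ) (hx : IsShortest O p σ x) {n : ℕ}
    (hn : n + 1 < p) : direction (x n) (x (n + 1)) ≠ direction (x (n + 1)) (x (n + 2)) := by
  intro h
  refine hσ.turn n hn ⟨(hσ.visible n (by omega)).1, (hσ.visible (n + 1) hn).1.symm, x (n + 1), ?_,
    hx.mem (n + 1)⟩
  exact segment_subset_convexHull (mem_union_left _ (hx.mem n)) (mem_union_right _ (hx.mem (n + 2)))
    (mem_segment_of_direction_eq (hx.ne_succ hO hσ (by omega)) (hx.ne_succ hO hσ hn) h)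

lemma inner_direction_sub_nonneg (hO : IsObstacleFamily O) (hσ : IsWalk O p σ)
    (hx : IsShortest O p σ x) {n : ℕ} (hn : n + 1 < p) :
    ∀ z ∈ obstacle O (σ (n + 1)), 0 ≤ inner ℝ
      (direction (x n) (x (n + 1)) - direction (x (n + 1)) (x (n + 2))) (z - x (n + 1)) :=
  fun _ hz => inner_direction_sub_nonneg_of_min (hO.convex_obstacle _) (hx.mem _)
    (hx.ne_succ hO hσ (by omega)) (hx.ne_succ hO hσ hn) (fun _ hz => hx.dist_add_dist_le hn hz) hz

lemma _root_.TorusBilliard.inner_direction_lt_one {a b c d : Space m} (hab : a ≠ b) (hcd : c ≠ d)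
    (h : direction a b ≠ direction c d) : inner ℝ (direction a b) (direction c d) < 1 :=
  (inner_lt_one_iff_real_of_norm_eq_one (norm_direction hab) (norm_direction hcd)).2 h

/-- The supporting hyperplane at the starting point of the `n`-th segment. -/
lemma exists_support_left (hO : IsObstacleFamily O) (hσ : IsWalk O p σ) (hx : IsShortest O p σ x)
    {n : ℕ} (hn : n < p) : ∃ g : Space m, (∀ z ∈ obstacle O (σ n), 0 ≤ inner ℝ g (z - x n)) ∧
      inner ℝ g (direction (x n) (x (n + 1))) < 0 := by
  have hne := hx.ne_succ hO hσ hn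
  rcases n with _ | n
  · refine ⟨direction (x 1) (x 0), fun z hz => inner_direction_nonneg_of_min
      (hO.convex_obstacle _) (hx.mem _) hne.symm (fun _ hz => hx.dist_first_le hn hz) hz, ?_⟩
    rw [direction_comm, inner_neg_left, real_inner_self_eq_norm_sq, norm_direction hne]
    norm_num
  -- At a reflection the functional is incoming minus outgoing direction. On the outgoing unit
  -- direction it equals their inner product minus `1`, negative since they differ.
  · refine ⟨_, hx.inner_direction_sub_nonneg hO hσ hn, ?_⟩
    rw [inner_sub_left, real_inner_self_eq_norm_sq, norm_direction hne]
    have := inner_direction_lt_one (hx.ne_succ hO hσ (by omega)) hne (hx.direction_ne hO hσ hn)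
    linarith

/-- The supporting hyperplane at the end of the `n`-th segment. -/
lemma exists_support_right (hO : IsObstacleFamily O) (hσ : IsWalk O p σ) (hx : IsShortest O p σ x)
    {n : ℕ} (hn : n < p) :
    ∃ g : Space m, (∀ z ∈ obstacle O (σ (n + 1)), 0 ≤ inner ℝ g (z - x (n + 1))) ∧
      0 < inner ℝ g (direction (x n) (x (n + 1))) := by
  have hne := hx.ne_succ hO hσ hn
  rcases eq_or_lt_of_le (show n + 1 ≤ p from hn) with rfl | hn'
  · refine ⟨direction (x n) (x (n + 1)), fun z hz => inner_direction_nonneg_of_min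
      (hO.convex_obstacle _) (hx.mem _) hne (fun _ hz => hx.dist_last_le hz) hz, ?_⟩
    rw [real_inner_self_eq_norm_sq, norm_direction hne]
    norm_num
  · refine ⟨_, hx.inner_direction_sub_nonneg hO hσ hn', ?_⟩
    have hne' := hx.ne_succ hO hσ hn'
    have := inner_direction_lt_one hne hne' (hx.direction_ne hO hσ hn')
    rw [inner_sub_left, real_inner_self_eq_norm_sq, norm_direction hne, real_inner_comm]
    linarith

/-- A shortest broken line is a piece of a billiard trajectory. -/
lemma isTrajectoryPiece (hO : IsObstacleFamily O) (hp : 0 < p) (hσ : IsWalk O p σ)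
    (hx : IsShortest O p σ x) : IsTrajectoryPiece O p σ x where
  mem_frontier n hn := by
    rcases eq_or_lt_of_le hn with rfl | hn
    · obtain ⟨k, rfl⟩ := Nat.exists_eq_succ_of_ne_zero hp.ne'
      obtain ⟨g, hg, hg'⟩ := hx.exists_support_right hO hσ (Nat.lt_succ_self k)
      refine mem_frontier_of_inner_nonneg (hx.mem _) ?_ hg
      rintro rfl
      simp at hg'
    · obtain ⟨g, hg, hg'⟩ := hx.exists_support_left hO hσ hn
      refine mem_frontier_of_inner_nonneg (hx.mem _) ?_ hg
      rintro rfl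
      simp at hg'
  ne_succ n hn := hx.ne_succ hO hσ hn
  segment_subset n hn := by
    have hne := hx.ne_succ hO hσ hn
    -- The table is a closure, so it suffices that the open segment avoids all obstacles: the
    -- supporting hyperplanes exclude the two end obstacles, visibility the others.
    rw [← closure_openSegment]
    refine closure_mono fun z hz => ?_
    rw [mem_compl_iff, mem_iUnion]
    rintro ⟨c, hc⟩
    have hd : 0 < dist (x n) (x (n + 1)) := dist_pos.2 hne
    rcases eq_or_ne c (σ n) with rfl | h1
    · obtain ⟨g, hg, hg'⟩ := hx.exists_support_left hO hσ hn
      rw [openSegment_eq_image'] at hz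
      obtain ⟨t, ht, rfl⟩ := hz
      have h := hg _ hc
      rw [add_sub_cancel_left, ← dist_smul_direction hne, real_inner_smul_right,
        real_inner_smul_right] at h
      nlinarith [mul_pos ht.1 hd]
    rcases eq_or_ne c (σ (n + 1)) with rfl | h2
    · obtain ⟨g, hg, hg'⟩ := hx.exists_support_right hO hσ hn
      rw [openSegment_symm, openSegment_eq_image'] at hz
      obtain ⟨t, ht, rfl⟩ := hz
      have h := hg _ hc
      rw [add_sub_cancel_left, ← neg_sub, ← dist_smul_direction hne, real_inner_smul_right,
        inner_neg_right, real_inner_smul_right] at h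
      nlinarith [mul_pos ht.1 hd]
    exact (hσ.visible n hn).2 c ⟨h1, h2, z, segment_subset_convexHull (mem_union_left _ (hx.mem n))
      (mem_union_right _ (hx.mem (n + 1))) (openSegment_subset_segment _ _ _ hz), hc⟩
  reflected n hn := isReflected_of_inner_nonneg (hx.ne_succ hO hσ (by omega))
    (hx.ne_succ hO hσ hn) (hx.direction_ne hO hσ hn) (hx.inner_direction_sub_nonneg hO hσ hn)

end IsShortest

/-! ### Trajectory pieces are almost shortest. -/

lemma eventually_mem_interior_of_fderiv_neg {S U : Set (Space m)} {x v : Space m}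
    {f : Space m → ℝ} (hU : IsOpen U) (hxU : x ∈ U) (hf : ContDiffOn ℝ 2 f U)
    (hfS : ∀ y ∈ U, (y ∈ S ↔ f y ≤ 0)) (hx : x ∈ S) (hv : fderiv ℝ f x v < 0) :
    ∀ᶠ t : ℝ in 𝓝[>] 0, x + t • v ∈ interior S := by
  have hdiff : HasFDerivAt f (fderiv ℝ f x) x :=
    ((hf.contDiffAt (hU.mem_nhds hxU)).differentiableAt (by norm_num)).hasFDerivAt
  have hline : HasDerivAt (fun t : ℝ => f (x + t • v)) (fderiv ℝ f x v) 0 := by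
    have h1 : HasDerivAt (fun t : ℝ => x + t • v) v 0 := by
      simpa using ((hasDerivAt_id (0 : ℝ)).smul_const v).const_add x
    have h2 : HasFDerivAt f (fderiv ℝ f x) (x + (0 : ℝ) • v) := by simpa using hdiff
    exact h2.comp_hasDerivAt 0 h1
  have hslope := (hasDerivAt_iff_tendsto_slope_zero.1 hline).mono_left
    (nhdsWithin_mono 0 fun t (ht : 0 < t) => ht.ne')
  have hU' : ∀ᶠ t : ℝ in 𝓝[>] 0, x + t • v ∈ U := by
    have hc : Continuous fun t : ℝ => x + t • v := by fun_prop
    refine nhdsWithin_le_nhds ((hc.tendsto 0).eventually (hU.mem_nhds ?_))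
    simpa using hxU
  have hfx : f x ≤ 0 := (hfS x hxU).1 hx
  filter_upwards [hslope.eventually (gt_mem_nhds hv), hU', self_mem_nhdsWithin] with t ht htU ht0
  have ht0' : (0 : ℝ) < t := ht0
  have hneg : f (x + t • v) < 0 := by
    simp only [zero_add, zero_smul, add_zero, smul_eq_mul] at ht
    have h3 := mul_neg_of_pos_of_neg ht0' ht
    rw [mul_inv_cancel_left₀ ht0'.ne'] at h3
    linarith
  have hopen : IsOpen (U ∩ f ⁻¹' Iio 0) := hf.continuousOn.isOpen_inter_preimage hU isOpen_Iio
  exact interior_maximal (fun y hy => (hfS y hy.1).2 (le_of_lt hy.2)) hopen ⟨htU, hneg⟩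

/-- A direction that points strictly inwards at a boundary point leads to interior points. -/
lemma HasC2Boundary.eventually_mem_interior {S : Set (Space m)} (hS : HasC2Boundary S)
    (hcl : IsClosed S) {x ν v : Space m} (hx : x ∈ frontier S) (hν : IsOuterUnitNormal S x ν)
    (hv : inner ℝ v ν < 0) : ∀ᶠ t : ℝ in 𝓝[>] 0, x + t • v ∈ interior S := by
  obtain ⟨U, hU, hxU, f, hf, hf0, hfS⟩ := hS x hx
  have hxS : x ∈ S := hcl.frontier_subset hx
  refine eventually_mem_interior_of_fderiv_neg hU hxU hf hfS hxS ?_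
  -- Directions in which `f` decreases enter `S`, hence lie in the half-space given by the normal.
  have hhalf : ∀ w, fderiv ℝ f x w < 0 → inner ℝ w ν ≤ 0 := by
    intro w hw
    obtain ⟨t, ht, ht0⟩ := ((eventually_mem_interior_of_fderiv_neg hU hxU hf hfS hxS hw).and
      self_mem_nhdsWithin).exists
    have h1 := hν.2 _ (interior_subset ht)
    rw [add_sub_cancel_left, real_inner_smul_left] at h1
    exact nonpos_of_mul_nonpos_right h1 ht0
  obtain ⟨w, hw⟩ : ∃ w, fderiv ℝ f x w < 0 := by
    by_contra! h
    refine hf0 x hxU (ContinuousLinearMap.ext fun w => le_antisymm ?_ (h w))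
    have := h (-w)
    rw [map_neg] at this
    simpa using this
  by_contra! hpos
  -- If `f` did not decrease along `v`, it would decrease along `-v + t • w` for every `t > 0`.
  -- Letting `t` tend to `0` in `hhalf` gives `0 ≤ inner ℝ v ν`. The inequality is multiplied by `t`
  -- to fit `nonneg_of_forall_add_sq`.
  have h1 : ∀ t : ℝ, 0 < t → t ≤ 1 → 0 ≤ t * inner ℝ v ν + t ^ 2 * (-inner ℝ w ν) := by
    intro t ht _
    have h2 := hhalf (-v + t • w) (by
      rw [map_add, map_neg, map_smul, smul_eq_mul]
      nlinarith [mul_neg_of_pos_of_neg ht hw])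
    rw [inner_add_left, inner_neg_left, real_inner_smul_left] at h2
    nlinarith
  linarith [nonneg_of_forall_add_sq h1]

lemma not_mem_table {a : Index m N} {x : Space m} (hx : x - latticePoint a.1 ∈ interior (O a.2)) :
    x ∉ table O := by
  rw [table, closure_compl, notMem_compl_iff]
  refine interior_mono (subset_iUnion _ a) ?_
  have h := (Homeomorph.addRight (latticePoint a.1)).image_interior (O a.2)
  rw [Homeomorph.coe_addRight] at h
  rw [obstacle, ← h]
  exact ⟨_, hx, by simp⟩

lemma sub_mem_frontier_of_mem_frontier_obstacle {a : Index m N} {x : Space m} (hx : x ∈ frontier (obstacle O a)) :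
    x - latticePoint a.1 ∈ frontier (O a.2) := by
  have h := (Homeomorph.addRight (latticePoint a.1)).image_frontier (O a.2)
  rw [Homeomorph.coe_addRight] at h
  rw [obstacle, ← h] at hx
  obtain ⟨y, hy, rfl⟩ := hx
  simpa using hy

namespace IsObstacleFamily

variable (hO : IsObstacleFamily O)
include hO

lemma norm_sub_latticePoint_le {a : Index m N} {x : Space m} (hx : x ∈ obstacle O a) :
    ‖x - latticePoint a.1‖ ≤ √m := by
  rw [EuclideanSpace.norm_eq]
  refine Real.sqrt_le_sqrt ?_
  have : ∀ i ∈ Finset.univ, ‖(x - latticePoint a.1) i‖ ^ 2 ≤ 1 := by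
    intro i _
    have h := hO.coord_mem hx i
    rw [Real.norm_eq_abs, sq_abs, PiLp.sub_apply, latticePoint_apply]
    nlinarith
  simpa using Finset.sum_le_sum this

lemma dist_le {a b : Index m N} {x y : Space m} (hx : x ∈ obstacle O a) (hy : y ∈ obstacle O b) :
    dist x y ≤ ‖latticePoint b.1 - latticePoint a.1‖ + 2 * √m := by
  have h1 := hO.norm_sub_latticePoint_le hx
  have h2 := hO.norm_sub_latticePoint_le hy
  have h3 : x - y = (x - latticePoint a.1) - (y - latticePoint b.1) -
      (latticePoint b.1 - latticePoint a.1) := by abel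
  rw [dist_eq_norm, h3]
  linarith [norm_sub_le ((x - latticePoint a.1) - (y - latticePoint b.1))
    (latticePoint b.1 - latticePoint a.1), norm_sub_le (x - latticePoint a.1)
    (y - latticePoint b.1)]

lemma dist_le_of_mem {a : Index m N} {x y : Space m} (hx : x ∈ obstacle O a)
    (hy : y ∈ obstacle O a) : dist x y ≤ 2 * √m := by
  simpa using hO.dist_le hx hy

lemma mem_of_mem_frontier {a : Index m N} {x : Space m} (hx : x ∈ frontier (obstacle O a)) :
    x ∈ obstacle O a := (hO.isCompact_obstacle a).isClosed.frontier_subset hx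

/-- A segment in the table that ends on an obstacle arrives from outside. -/
lemma inner_sub_nonpos_of_segment_subset {a : Index m N} {x y ν : Space m}
    (hy : y ∈ frontier (obstacle O a)) (hν : IsOuterUnitNormal (obstacle O a) y ν)
    (hseg : segment ℝ x y ⊆ table O) : inner ℝ (y - x) ν ≤ 0 := by
  by_contra! hpos
  have hν' : IsOuterUnitNormal (O a.2) (y - latticePoint a.1) ν := by
    refine ⟨hν.1, fun z hz => ?_⟩
    have := hν.2 (z + latticePoint a.1) ⟨z, hz, rfl⟩
    rwa [sub_sub_eq_add_sub]
  have hv : inner ℝ (x - y) ν < 0 := by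
    rw [← neg_sub, inner_neg_left]
    linarith
  have hev := (hO.hasC2Boundary a.2).eventually_mem_interior (hO.isCompact a.2).isClosed
    (sub_mem_frontier_of_mem_frontier_obstacle hy) hν' hv
  obtain ⟨t, ht, ht0, ht1⟩ := (hev.and (Ioc_mem_nhdsGT (zero_lt_one' ℝ))).exists
  refine not_mem_table (a := a) (x := y + t • (x - y)) ?_ (hseg ?_)
  · rwa [add_sub_right_comm]
  · rw [segment_symm, segment_eq_image']
    exact ⟨t, ⟨ht0.le, ht1⟩, rfl⟩

/-- Reflection changes the left side by `-2 * ⟪direction x y, ν⟫ * ⟪w - y, ν⟫`, and both factors are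
nonpositive: the particle arrives from outside, and `ν` is an outer normal. This is the sign that
makes the sum over a trajectory telescope to an inequality. -/
lemma inner_direction_le_of_isReflected {a : Index m N} {x y z w : Space m} (hxy : x ≠ y)
    (hy : y ∈ frontier (obstacle O a)) (hseg : segment ℝ x y ⊆ table O)
    (hr : IsReflected (obstacle O a) x y z) (hw : w ∈ obstacle O a) :
    inner ℝ (direction y z) (w - y) ≤ inner ℝ (direction x y) (w - y) := by
  obtain ⟨ν, hν, h⟩ := hr
  have h1 := hO.inner_sub_nonpos_of_segment_subset hy hν hseg
  rw [← dist_smul_direction hxy, real_inner_smul_left] at h1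
  have h2 : inner ℝ (direction x y) ν ≤ 0 := nonpos_of_mul_nonpos_right h1 (dist_pos.2 hxy)
  have h3 := hν.2 w hw
  rw [h, inner_sub_left, real_inner_smul_left]
  rw [real_inner_comm] at h3
  nlinarith [mul_nonneg_of_nonpos_of_nonpos h2 h3]

end IsObstacleFamily

/-- A piece of a trajectory is, up to a bounded error, a shortest broken line of its type. -/
lemma IsTrajectoryPiece.pieceLength_le (hO : IsObstacleFamily O) {p : ℕ} {σ : ℕ → Index m N}
    {x y : ℕ → Space m} (hx : IsTrajectoryPiece O p σ x)
    (hy : ∀ n, n ≤ p → y n ∈ obstacle O (σ n)) :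
    pieceLength p x ≤ pieceLength p y + 4 * √m := by
  rcases p with _ | p
  · simp only [pieceLength, Finset.range_zero, Finset.sum_empty]
    positivity
  have hcs : ∀ n, n ≤ p → ∀ v, |inner ℝ (direction (x n) (x (n + 1))) v| ≤ ‖v‖ := by
    intro n hn v
    simpa [norm_direction (hx.ne_succ n (by omega))] using
      abs_real_inner_le_norm (direction (x n) (x (n + 1))) v
  -- Each edge of `y` is at least its component along the matching direction of `x`. On summing, the
  -- terms at the reflections have a favourable sign, and only the two end terms remain, each at
  -- most `2 * √m`.
  have key : ∀ k, k ≤ p → pieceLength (k + 1) x +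
      inner ℝ (direction (x k) (x (k + 1))) (y (k + 1) - x (k + 1)) -
      inner ℝ (direction (x 0) (x 1)) (y 0 - x 0) ≤ pieceLength (k + 1) y := by
    intro k hk
    have hstep : ∀ n, n ≤ p → dist (x n) (x (n + 1)) +
        inner ℝ (direction (x n) (x (n + 1))) (y (n + 1) - x (n + 1)) -
        inner ℝ (direction (x n) (x (n + 1))) (y n - x n) ≤ dist (y n) (y (n + 1)) := by
      intro n hn
      rw [← inner_direction (hx.ne_succ n (by omega)), ← inner_add_right, ← inner_sub_right,
        dist_comm, dist_eq_norm]
      have : x (n + 1) - x n + (y (n + 1) - x (n + 1)) - (y n - x n) = y (n + 1) - y n := by abel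
      rw [this]
      exact (le_abs_self _).trans (hcs n hn _)
    induction k with
    | zero => simpa [pieceLength_one] using hstep 0 (by omega)
    | succ k ih =>
      have h1 := ih (by omega)
      have h2 := hstep (k + 1) hk
      have h3 := hO.inner_direction_le_of_isReflected (hx.ne_succ k (by omega))
        (hx.mem_frontier (k + 1) (by omega)) (hx.segment_subset k (by omega))
        (hx.reflected k (by omega)) (hy (k + 1) (by omega))
      rw [pieceLength_add, pieceLength_one, pieceLength_add _ _ y, pieceLength_one]
      linarith
  have h1 := key p le_rfl
  have h2 := (abs_le.1 (hcs p le_rfl (y (p + 1) - x (p + 1)))).1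
  have h3 := (abs_le.1 (hcs 0 (by omega) (y 0 - x 0))).2
  have h4 := hO.dist_le_of_mem (hy (p + 1) le_rfl)
    (hO.mem_of_mem_frontier (hx.mem_frontier (p + 1) le_rfl))
  have h5 := hO.dist_le_of_mem (hy 0 (by omega))
    (hO.mem_of_mem_frontier (hx.mem_frontier 0 (by omega)))
  rw [dist_eq_norm] at h4 h5
  simp only [zero_add] at h3
  linarith

/-! ### Gluing, reversing and translating walks. -/

/-- The translate of a pair of indices. -/
def shiftPair (k : Fin m → ℤ) (s : Index m N × Index m N) : Index m N × Index m N :=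
  (shift k s.1, shift k s.2)

lemma shiftPair_shiftPair (k l : Fin m → ℤ) (s : Index m N × Index m N) :
    shiftPair k (shiftPair l s) = shiftPair (l + k) s := by
  simp [shiftPair, shift_shift]

@[simp] lemma shiftPair_zero (s : Index m N × Index m N) : shiftPair 0 s = s := by
  simp [shiftPair]

/-- Two walks such that the last edge of the first one is the first edge of the second one. -/
def glue (p : ℕ) {α : Type*} (σ τ : ℕ → α) (n : ℕ) : α := if n ≤ p then σ n else τ (n - p)

lemma glue_of_le {α : Type*} {p : ℕ} {σ τ : ℕ → α} {n : ℕ} (hn : n ≤ p) : glue p σ τ n = σ n :=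
  if_pos hn

lemma glue_add_succ {α : Type*} (p : ℕ) (σ τ : ℕ → α) (n : ℕ) :
    glue p σ τ (p + (n + 1)) = τ (n + 1) := by
  rw [glue, if_neg (by omega)]
  congr 1
  omega

lemma glue_add {α : Type*} {p : ℕ} {σ τ : ℕ → α} (h : σ p = τ 0) (n : ℕ) :
    glue p σ τ (p + n) = τ n := by
  cases n with
  | zero => simpa [glue] using h
  | succ n => exact glue_add_succ p σ τ n

lemma glue_of_le_succ {α : Type*} {p : ℕ} {σ τ : ℕ → α} (h : σ (p + 1) = τ 1) {n : ℕ}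
    (hn : n ≤ p + 1) : glue p σ τ n = σ n := by
  rcases Nat.le_succ_iff.1 hn with hn | rfl
  · exact glue_of_le hn
  · exact (glue_add_succ p σ τ 0).trans h.symm

/-- Because a whole edge is shared, any three consecutive obstacles of the glued walk belong to one
of the two walks. -/
lemma IsWalk.glue {p q : ℕ} {σ τ : ℕ → Index m N} (hσ : IsWalk O (p + 1) σ)
    (hτ : IsWalk O (q + 1) τ) (h0 : σ p = τ 0) (h1 : σ (p + 1) = τ 1) :
    IsWalk O (p + (q + 1)) (glue p σ τ) where
  visible n hn := by
    rcases le_or_gt n p with h | h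
    · rw [glue_of_le_succ h1 (by omega), glue_of_le_succ h1 (by omega)]
      exact hσ.visible n (by omega)
    · obtain ⟨k, rfl⟩ := Nat.exists_eq_add_of_le h.le
      rw [add_assoc, glue_add h0, glue_add h0]
      exact hτ.visible k (by omega)
  turn n hn := by
    rcases lt_or_ge n p with h | h
    · rw [glue_of_le_succ h1 (by omega), glue_of_le_succ h1 (by omega),
        glue_of_le_succ h1 (by omega)]
      exact hσ.turn n (by omega)
    · obtain ⟨k, rfl⟩ := Nat.exists_eq_add_of_le h
      rw [add_assoc, add_assoc, glue_add h0, glue_add h0, glue_add h0]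
      exact hτ.turn k (by omega)

lemma IsWalk.reverse {p : ℕ} {σ : ℕ → Index m N} (hσ : IsWalk O p σ) :
    IsWalk O p fun n => σ (p - n) where
  visible n hn := by
    obtain ⟨k, rfl⟩ := Nat.exists_eq_add_of_le' hn
    have h := (hσ.visible k (by omega)).symm
    convert h using 2 <;> omega
  turn n hn := by
    obtain ⟨k, rfl⟩ := Nat.exists_eq_add_of_le' hn
    have h := hσ.turn k (by omega)
    rw [isBetween_comm] at h
    convert h using 3 <;> omega

lemma IsWalk.shift {p : ℕ} {σ : ℕ → Index m N} (hσ : IsWalk O p σ) (k : Fin m → ℤ) :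
    IsWalk O p fun n => shift k (σ n) :=
  ⟨fun n hn => visible_shift.2 (hσ.visible n hn), fun n hn h => hσ.turn n hn (isBetween_shift.1 h)⟩

lemma pieceLength_reverse (p : ℕ) (x : ℕ → Space m) :
    pieceLength p (fun n => x (p - n)) = pieceLength p x := by
  rw [pieceLength, pieceLength, ← Finset.sum_range_reflect]
  refine Finset.sum_congr rfl fun n hn => ?_
  rw [Finset.mem_range] at hn
  rw [dist_comm]
  congr 2 <;> omega

lemma pieceLength_sub_const (p : ℕ) (x : ℕ → Space m) (v : Space m) :
    pieceLength p (fun n => x n - v) = pieceLength p x := by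
  simp [pieceLength]

lemma IsShortest.reverse {p : ℕ} {σ : ℕ → Index m N} {x : ℕ → Space m} (hx : IsShortest O p σ x) :
    IsShortest O p (fun n => σ (p - n)) fun n => x (p - n) where
  mem n := hx.mem _
  le y hy := by
    rw [pieceLength_reverse, ← pieceLength_reverse p y]
    refine hx.le _ fun n hn => ?_
    have := hy (p - n) (by omega)
    rwa [Nat.sub_sub_self hn] at this

lemma IsShortest.shift {p : ℕ} {σ : ℕ → Index m N} {x : ℕ → Space m} (hx : IsShortest O p σ x)
    (k : Fin m → ℤ) :
    IsShortest O p (fun n => shift k (σ n)) fun n => x n - latticePoint (-k) where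
  mem n := by
    rw [mem_obstacle_shift, latticePoint_neg]
    simpa using hx.mem n
  le y hy := by
    rw [pieceLength_sub_const, ← pieceLength_sub_const p y (latticePoint k)]
    exact hx.le _ fun n hn => mem_obstacle_shift.1 (hy n hn)

/-! ### Almost additivity of shortest lengths. -/

/-- There is a walk with first edge `s` and last edge `t` for which the shortest broken line has
length `L`. -/
def Connects (O : Fin N → Set (Space m)) (s t : Index m N × Index m N) (L : ℝ) : Prop :=
  ∃ (p : ℕ) (σ : ℕ → Index m N) (x : ℕ → Space m), IsWalk O (p + 1) σ ∧
    IsShortest O (p + 1) σ x ∧ σ 0 = s.1 ∧ σ 1 = s.2 ∧ σ p = t.1 ∧ σ (p + 1) = t.2 ∧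
    pieceLength (p + 1) x = L

/-- The edge `t` continues `s` and its length is bounded. -/
structure Hop (O : Fin N → Set (Space m)) (s t : Index m N × Index m N) : Prop where
  fst_eq : t.1 = s.2
  visible : Visible O t.1 t.2
  turn : ¬ IsBetween O s.2 s.1 t.2
  norm_le : ‖latticePoint t.2.1 - latticePoint t.1.1‖ ≤ 1

/-- The edge `t` can be reached from `s` by `n` bounded edges. -/
inductive Reaches (O : Fin N → Set (Space m)) :
    ℕ → Index m N × Index m N → Index m N × Index m N → Prop
  | refl (s : Index m N × Index m N) : Reaches O 0 s s
  | tail {n : ℕ} {s t u : Index m N × Index m N} :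
      Reaches O n s t → Hop O t u → Reaches O (n + 1) s u

lemma Hop.reaches {s t : Index m N × Index m N} (h : Hop O s t) : Reaches O 1 s t :=
  .tail (.refl s) h

lemma Reaches.trans {n k : ℕ} {s t u : Index m N × Index m N} (h : Reaches O n s t)
    (h' : Reaches O k t u) : Reaches O (n + k) s u := by
  induction h' with
  | refl => exact h
  | tail _ h2 ih => exact .tail (ih h) h2

lemma Reaches.norm_le {n : ℕ} {s t : Index m N × Index m N} (h : Reaches O n s t) :
    ‖latticePoint t.2.1 - latticePoint s.2.1‖ ≤ n := by
  induction h with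
  | refl => simp
  | @tail n s t u _ h2 ih =>
    have h3 := h2.norm_le
    rw [h2.fst_eq] at h3
    push_cast
    linarith [norm_sub_le_norm_sub_add_norm_sub (latticePoint u.2.1) (latticePoint t.2.1)
      (latticePoint s.2.1)]

namespace Connects

variable {s t u : Index m N × Index m N} {L L' : ℝ}

lemma reverse (h : Connects O s t L) : Connects O t.swap s.swap L := by
  obtain ⟨p, σ, x, hσ, hx, h0, h1, h2, h3, hL⟩ := h
  refine ⟨p, _, _, hσ.reverse, hx.reverse, ?_, ?_, ?_, ?_, (pieceLength_reverse _ _).trans hL⟩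
  · simpa using h3
  · simpa using h2
  · simpa using h1
  · simpa using h0

lemma shift (h : Connects O s t L) (k : Fin m → ℤ) :
    Connects O (shiftPair k s) (shiftPair k t) L := by
  obtain ⟨p, σ, x, hσ, hx, h0, h1, h2, h3, hL⟩ := h
  exact ⟨p, _, _, hσ.shift k, hx.shift k, by simp [h0, shiftPair], by simp [h1, shiftPair],
    by simp [h2, shiftPair], by simp [h3, shiftPair], (pieceLength_sub_const _ _ _).trans hL⟩

/-- Dropping the last vertex of the new shortest line gives the lower bound; appending a bounded
segment to the old one gives the upper bound. -/
lemma hop (hO : IsObstacleFamily O) (h : Connects O s t L) (htu : Hop O t u) :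
    ∃ L', L ≤ L' ∧ L' ≤ L + (1 + 2 * √m) ∧ Connects O s u L' := by
  obtain ⟨p, σ, x, hσ, hx, h0, h1, h2, h3, rfl⟩ := h
  set τ : ℕ → Index m N := fun n => if n = 0 then t.1 else if n = 1 then t.2 else u.2
  have hvis : Visible O t.1 t.2 := by
    rw [← h2, ← h3]
    exact hσ.visible p (by omega)
  have hτ : IsWalk O (1 + 1) τ := by
    constructor
    · intro n hn
      interval_cases n
      · simpa [τ] using hvis
      · have := htu.visible
        rw [htu.fst_eq] at this
        simpa [τ] using this
    · intro n hn
      obtain rfl : n = 0 := by omega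
      simpa [τ] using htu.turn
  have e0 : σ p = τ 0 := by simp [τ, h2]
  have e1 : σ (p + 1) = τ 1 := by simp [τ, h3]
  obtain ⟨y, hy⟩ := hO.exists_isShortest (p + 1 + 1) (glue p σ τ)
  refine ⟨pieceLength (p + 1 + 1) y, ?_, ?_, p + 1, _, y, hσ.glue hτ e0 e1, hy, ?_, ?_, ?_, ?_, rfl⟩
  · have h4 := hx.le y fun n hn => by
      rw [← glue_of_le_succ (τ := τ) e1 hn]
      exact hy.mem n
    rw [pieceLength_add (p + 1)]
    linarith [pieceLength_nonneg 1 fun n => y (p + 1 + n)]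
  · have h4 := hy.le (fun n => if n ≤ p + 1 then x n else y n) fun n hn => by
      by_cases h : n ≤ p + 1
      · rw [glue_of_le_succ e1 h, if_pos h]
        exact hx.mem n
      · rw [if_neg h]
        exact hy.mem n
    rw [pieceLength_add (p + 1), pieceLength_add (p + 1), pieceLength_one, pieceLength_one,
      pieceLength_congr (x := fun n => if n ≤ p + 1 then x n else y n) (y := x)
        (fun n hn => if_pos hn)] at h4
    rw [pieceLength_add (p + 1), pieceLength_one]
    have h5 : dist (x (p + 1)) (y (p + 1 + 1)) ≤ 1 + 2 * √m := by
      have h6 := hx.mem (p + 1)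
      have h7 := hy.mem (p + 1 + 1)
      have h8 : glue p σ τ (p + 1 + 1) = u.2 := by simpa [τ] using glue_add e0 2
      rw [h3] at h6
      rw [h8] at h7
      have h9 := htu.norm_le
      rw [htu.fst_eq] at h9
      linarith [hO.dist_le h6 h7]
    simp at h4
    simp
    linarith
  · rw [glue_of_le_succ e1 (by omega), h0]
  · rw [glue_of_le_succ e1 (by omega), h1]
  · rw [glue_of_le_succ e1 le_rfl, h3, htu.fst_eq]
  · simpa [τ] using glue_add e0 2

lemma reaches (hO : IsObstacleFamily O) {n : ℕ} (h : Connects O s t L) (htu : Reaches O n t u) :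
    ∃ L', L ≤ L' ∧ L' ≤ L + n * (1 + 2 * √m) ∧ Connects O s u L' := by
  induction htu with
  | refl => exact ⟨L, le_rfl, by simp, h⟩
  | tail _ h2 ih =>
    obtain ⟨L₁, h3, h4, h5⟩ := ih h
    obtain ⟨L₂, h6, h7, h8⟩ := h5.hop hO h2
    refine ⟨L₂, h3.trans h6, ?_, h8⟩
    push_cast
    linarith

/-- A shortest line of the glued walk restricts to both walks, counting the shared bounded edge
twice. Conversely, the first shortest line without its last vertex and the second without its first
are joined by one bounded segment. -/
lemma glue (hO : IsObstacleFamily O) (h : Connects O s t L) (h' : Connects O t u L')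
    (ht : ‖latticePoint t.2.1 - latticePoint t.1.1‖ ≤ 1) :
    ∃ L'', |L'' - (L + L')| ≤ 1 + 2 * √m ∧ Connects O s u L'' := by
  obtain ⟨p, σ, x, hσ, hx, h0, h1, h2, h3, rfl⟩ := h
  obtain ⟨q, τ, y, hτ, hy, h0', h1', h2', h3', rfl⟩ := h'
  have e0 : σ p = τ 0 := h2.trans h0'.symm
  have e1 : σ (p + 1) = τ 1 := h3.trans h1'.symm
  obtain ⟨z, hz⟩ := hO.exists_isShortest (p + q + 1) (TorusBilliard.glue p σ τ)
  refine ⟨pieceLength (p + q + 1) z, ?_, p + q, _, z, hσ.glue hτ e0 e1, hz, ?_, ?_, ?_, ?_, rfl⟩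
  · have hbound : ∀ v ∈ obstacle O t.1, ∀ w ∈ obstacle O t.2, dist v w ≤ 1 + 2 * √m :=
      fun v hv w hw => (hO.dist_le hv hw).trans (by linarith)
    have hshift : ∀ v : ℕ → Space m, pieceLength (p + q + 1) v =
        pieceLength p v + dist (v p) (v (p + 1)) + pieceLength q fun n => v (p + (n + 1)) := by
      intro v
      rw [add_right_comm, pieceLength_add, pieceLength_add, pieceLength_one]
      simp only [add_assoc, add_zero, add_comm 1]
    have hsucc : ∀ v : ℕ → Space m, pieceLength (q + 1) v =
        dist (v 0) (v 1) + pieceLength q fun n => v (n + 1) := by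
      intro v
      rw [add_comm, pieceLength_add, pieceLength_one]
      simp only [add_comm 1]
    rw [abs_le]
    constructor
    · have h4 := hx.le z fun n hn => by
        rw [← glue_of_le_succ (τ := τ) e1 hn]
        exact hz.mem n
      have h5 := hy.le (fun n => z (p + n)) fun n hn => by
        rw [← glue_add e0 n]
        exact hz.mem _
      have h6 : dist (z p) (z (p + 1)) ≤ 1 + 2 * √m := by
        refine hbound _ ?_ _ ?_
        · have := hz.mem p
          rwa [glue_of_le le_rfl, h2] at this
        · have := hz.mem (p + 1)
          rwa [glue_of_le_succ e1 le_rfl, h3] at this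
      rw [hsucc fun n => z (p + n)] at h5
      rw [pieceLength_add p 1 z, pieceLength_one] at h4
      rw [hshift]
      simp only [add_zero] at h4 h5
      linarith
    · have h4 := hz.le (TorusBilliard.glue p x y) fun n hn => by
        unfold TorusBilliard.glue
        split_ifs
        exacts [hx.mem n, hy.mem _]
      have h6 : dist (x p) (y 1) ≤ 1 + 2 * √m := hbound _ (h2 ▸ hx.mem p) _ (h1' ▸ hy.mem 1)
      rw [hshift (TorusBilliard.glue p x y), glue_of_le le_rfl, glue_add_succ p x y 0,
        pieceLength_congr fun n hn => glue_of_le hn] at h4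
      simp only [glue_add_succ, zero_add] at h4
      rw [hsucc y, pieceLength_add p 1 x]
      linarith [pieceLength_nonneg 1 fun n => x (p + n), dist_nonneg (x := y 0) (y := y 1)]
  · rw [glue_of_le_succ e1 (by omega), h0]
  · rw [glue_of_le_succ e1 (by omega), h1]
  · rw [glue_add e0, h2']
  · rw [add_assoc, glue_add e0, h3']

end Connects

/-! ### Reaching a fixed unit step from any edge. -/

/-- The edge given by a lattice vector `u` from the obstacle number `r`. -/
def stepEdge (N : ℕ) (u : Fin m → ℤ) (r : Fin N) : Index m N × Index m N := ((0, r), (u, r))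

lemma stepEdge_swap (u : Fin m → ℤ) (r : Fin N) :
    (stepEdge N u r).swap = shiftPair u (stepEdge N (-u) r) := by
  simp [stepEdge, shiftPair, shift]

lemma shiftPair_swap (k : Fin m → ℤ) (s : Index m N × Index m N) :
    (shiftPair k s).swap = shiftPair k s.swap := rfl

lemma norm_latticePoint_shift_sub {u : Fin m → ℤ} (hu : IsStep u) (b : Index m N) :
    ‖latticePoint (shift u b).1 - latticePoint b.1‖ ≤ 1 := by
  rw [shift_fst, latticePoint_add, add_sub_cancel_left, hu.norm_latticePoint]

namespace IsObstacleFamily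

variable (hO : IsObstacleFamily O)
include hO

lemma exists_hop_step (hm : 2 ≤ m) (s : Index m N × Index m N) (hs : s.1 ≠ s.2) :
    ∃ u, IsStep u ∧ Hop O s (shiftPair s.2.1 (stepEdge N u s.2.2)) := by
  have : NeZero m := ⟨by omega⟩
  obtain ⟨u, hu, h⟩ := hO.exists_step_not_isBetween hs
  have e : shiftPair s.2.1 (stepEdge N u s.2.2) = (s.2, shift u s.2) := by
    simp [shiftPair, stepEdge, shift, add_comm]
  refine ⟨u, hu, ?_⟩
  rw [e]
  exact ⟨rfl, hO.visible_step hm hu _, h, norm_latticePoint_shift_sub hu _⟩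

lemma hop_step_step (hm : 2 ≤ m) {u w : Fin m → ℤ} (hu : IsStep u) (hw : IsStep w) (h : u ≠ w)
    (k : Fin m → ℤ) (r : Fin N) :
    Hop O (shiftPair k (stepEdge N u r)) (shiftPair (k + u) (stepEdge N w r)) := by
  have e : shiftPair (k + u) (stepEdge N w r) = ((k + u, r), shift w (k + u, r)) := by
    simp [shiftPair, stepEdge, shift, add_comm]
  have e' : shiftPair k (stepEdge N u r) = (shift (-u) (k + u, r), (k + u, r)) := by
    simp [shiftPair, stepEdge, shift, add_comm]
  rw [e, e']
  exact ⟨rfl, hO.visible_step hm hw _, hO.not_isBetween_step_step hu hw h _,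
    norm_latticePoint_shift_sub hw _⟩

lemma exists_reaches_step_step (hm : 2 ≤ m) {u w : Fin m → ℤ} (hu : IsStep u) (hw : IsStep w)
    (k : Fin m → ℤ) (r : Fin N) : ∃ n ≤ 2, ∃ l,
      Reaches O n (shiftPair k (stepEdge N u r)) (shiftPair l (stepEdge N w r)) := by
  rcases ne_or_eq u w with h | rfl
  · exact ⟨1, by norm_num, _, (hO.hop_step_step hm hu hw h k r).reaches⟩
  -- Two equal steps in a row are not allowed, as the middle obstacle lies between its translates; a
  -- step `-u` is inserted.
  · have hne : u ≠ -u := by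
      intro h
      have h1 := hu.dotProduct_self
      nth_rewrite 1 [h] at h1
      rw [neg_dotProduct, hu.dotProduct_self] at h1
      norm_num at h1
    exact ⟨2, le_rfl, _, .tail (hO.hop_step_step hm hu hu.neg hne k r).reaches
      (hO.hop_step_step hm hu.neg hu hne.symm _ r)⟩

/-- Every edge can be continued by boundedly many bounded edges to a translate of a given unit
step. -/
lemma exists_reaches_stepEdge (hm : 2 ≤ m) (s : Index m N × Index m N) (hs : s.1 ≠ s.2)
    {w : Fin m → ℤ} (hw : IsStep w) (r : Fin N) :
    ∃ n ≤ 7, ∃ l, Reaches O n s (shiftPair l (stepEdge N w r)) := by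
  have : NeZero m := ⟨by omega⟩
  obtain ⟨u, hu, h1⟩ := hO.exists_hop_step hm s hs
  rcases eq_or_ne s.2.2 r with rfl | hr
  · obtain ⟨n, hn, l, h2⟩ := hO.exists_reaches_step_step hm hu hw s.2.1 s.2.2
    exact ⟨1 + n, by omega, l, h1.reaches.trans h2⟩
  set q := s.2.2
  -- To change the number from `q` to `r` inside a cube, read backwards a passage from `r` to `q`
  -- followed by a step `v`: arriving at `q` by `-v`, one may go on to `r`. The total is at most `1
  -- + 2 + 1 + 1 + 2 = 7` edges.
  obtain ⟨v, hv, h3⟩ := hO.exists_step_not_isBetween (a := (0, r)) (b := (0, q))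
    fun h => hr (congrArg Prod.snd h).symm
  obtain ⟨n, hn, l, h2⟩ := hO.exists_reaches_step_step hm hu hv.neg s.2.1 q
  have h4 : Hop O (shiftPair l (stepEdge N (-v) q)) ((-v + l, q), (-v + l, r)) := by
    refine ⟨rfl, hO.visible_of_fst_eq rfl hr, ?_, by simp⟩
    intro h
    refine h3 (isBetween_shift (k := -v + l).1 (isBetween_comm.1 ?_))
    simpa [shiftPair, stepEdge, shift] using h
  obtain ⟨v', hv', h5⟩ := hO.exists_hop_step hm ((-v + l, q), (-v + l, r))
    fun h => hr (congrArg Prod.snd h)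
  obtain ⟨n', hn', l', h6⟩ := hO.exists_reaches_step_step hm hv' hw (-v + l) r
  exact ⟨1 + n + 1 + 1 + n', by omega, l',
    (((h1.reaches.trans h2).trans h4.reaches).trans h5.reaches).trans h6⟩

end IsObstacleFamily

/-! ### Loops and their correspondence with trajectory pieces. -/

/-- There is a closed walk of length `L` and displacement `k` that starts with the edge `s`. -/
def IsLoop (O : Fin N → Set (Space m)) (s : Index m N × Index m N) (k : Fin m → ℤ) (L : ℝ) : Prop :=
  Connects O s (shiftPair k s) L

namespace IsLoop

variable {u : Fin m → ℤ} {r : Fin N} {k l : Fin m → ℤ} {L L' : ℝ}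

lemma add (hO : IsObstacleFamily O) (hu : IsStep u) (h : IsLoop O (stepEdge N u r) k L)
    (h' : IsLoop O (stepEdge N u r) l L') :
    ∃ L'', |L'' - (L + L')| ≤ 1 + 2 * √m ∧ IsLoop O (stepEdge N u r) (k + l) L'' := by
  have h1 := h'.shift k
  rw [shiftPair_shiftPair, add_comm l k] at h1
  refine Connects.glue hO h h1 ?_
  simp [shiftPair, stepEdge, latticePoint_add, hu.norm_latticePoint]

lemma exists_zero (hO : IsObstacleFamily O) (hm : 2 ≤ m) (hu : IsStep u) (r : Fin N) :
    ∃ L, |L| ≤ 1 + 2 * √m ∧ IsLoop O (stepEdge N u r) 0 L := by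
  have hv := hO.visible_step hm hu (0, r)
  obtain ⟨x, hx⟩ := hO.exists_isShortest (0 + 1) fun n => if n = 0 then (0, r) else shift u (0, r)
  refine ⟨pieceLength 1 x, ?_, 0, _, x, ⟨?_, ?_⟩, hx, ?_, ?_, ?_, ?_, rfl⟩
  · rw [abs_of_nonneg (pieceLength_nonneg _ _), pieceLength_one]
    have h0 := hx.mem 0
    have h1 := hx.mem 1
    simp only [if_true, one_ne_zero, if_false] at h0 h1
    linarith [hO.dist_le h0 h1, norm_latticePoint_shift_sub hu (0, r)]
  · intro n hn
    obtain rfl : n = 0 := by omega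
    simpa using hv
  · intro n hn
    omega
  all_goals simp [stepEdge, shift]

/-- Each gluing costs a bounded error, so relative to `n * L` the total error is of order `1 / L`:
small for long basic loops, however large `n` is. -/
lemma nsmul (hO : IsObstacleFamily O) (hm : 2 ≤ m) (hu : IsStep u)
    (h : IsLoop O (stepEdge N u r) k L) (n : ℕ) :
    ∃ L', |L' - n * L| ≤ (n + 1) * (1 + 2 * √m) ∧ IsLoop O (stepEdge N u r) (n • k) L' := by
  induction n with
  | zero => simpa using exists_zero hO hm hu r
  | succ n ih =>
    obtain ⟨L₁, h1, h2⟩ := ih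
    obtain ⟨L₂, h3, h4⟩ := add hO hu h2 h
    refine ⟨L₂, ?_, by rwa [succ_nsmul]⟩
    rw [abs_le] at *
    push_cast
    constructor <;> linarith [h1.1, h1.2, h3.1, h3.2]

/-- A loop gives a piece of a trajectory of the same length and almost the same displacement. -/
lemma exists_isTrajectoryPiece (hO : IsObstacleFamily O) (hu : IsStep u)
    (h : IsLoop O (stepEdge N u r) k L) :
    ∃ (p : ℕ) (x : ℕ → Space m), (∃ σ, IsAdmissible O p σ ∧ IsTrajectoryPiece O p σ x) ∧
      pieceLength p x = L ∧ ‖displacement p x - latticePoint k‖ ≤ 1 + 2 * √m := by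
  obtain ⟨p, σ, x, hσ, hx, h0, h1, h2, h3, hL⟩ := h
  refine ⟨p + 1, x, ⟨σ, hσ.isAdmissible (by rw [h0]; rfl),
    hx.isTrajectoryPiece hO (by omega) hσ⟩, hL, ?_⟩
  have h4 := hO.norm_sub_latticePoint_le (hx.mem 0)
  have h5 := hO.norm_sub_latticePoint_le (hx.mem (p + 1))
  rw [h0] at h4
  rw [h3] at h5
  simp only [stepEdge, latticePoint_zero, sub_zero, shiftPair, shift_fst, latticePoint_add] at h4 h5
  have h6 : displacement (p + 1) x - latticePoint k =
      (x (p + 1) - (latticePoint u + latticePoint k)) - x 0 + latticePoint u := by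
    rw [displacement]
    abel
  rw [h6]
  have h7 := norm_add_le (x (p + 1) - (latticePoint u + latticePoint k) - x 0) (latticePoint u)
  have h8 := norm_sub_le (x (p + 1) - (latticePoint u + latticePoint k)) (x 0)
  rw [hu.norm_latticePoint] at h7
  linarith

end IsLoop

/-- A piece of a trajectory gives a loop of almost the same length and displacement. -/
lemma IsTrajectoryPiece.exists_isLoop (hO : IsObstacleFamily O) (hm : 2 ≤ m) {u : Fin m → ℤ}
    (hu : IsStep u) (r : Fin N) {p : ℕ} {σ : ℕ → Index m N} {x : ℕ → Space m}
    (hx : IsTrajectoryPiece O (p + 1) σ x) (hσ : IsWalk O (p + 1) σ) :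
    ∃ k L, IsLoop O (stepEdge N u r) k L ∧ |L - pieceLength (p + 1) x| ≤ 15 * (1 + 2 * √m) ∧
      ‖latticePoint k - displacement (p + 1) x‖ ≤ 15 * (1 + 2 * √m) := by
  have hm0 : 0 ≤ √m := Real.sqrt_nonneg _
  have hmem : ∀ n, n ≤ p + 1 → x n ∈ obstacle O (σ n) := fun n hn =>
    hO.mem_of_mem_frontier (hx.mem_frontier n hn)
  obtain ⟨y, hy⟩ := hO.exists_isShortest (p + 1) σ
  have h1 := hx.pieceLength_le hO fun n _ => hy.mem n
  have h2 := hy.le x hmem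
  have hc : Connects O (σ 0, σ 1) (σ p, σ (p + 1)) (pieceLength (p + 1) y) :=
    ⟨p, σ, y, hσ, hy, rfl, rfl, rfl, rfl, rfl⟩
  obtain ⟨n₁, hn₁, l₁, hr₁⟩ := hO.exists_reaches_stepEdge hm (σ p, σ (p + 1))
    (hσ.visible p (by omega)).1.symm hu r
  -- The beginning is extended by working on the reversed walk. Its target is the step `-u`, which
  -- read backwards is a translate of the step `u`.
  obtain ⟨n₂, hn₂, l₂, hr₂⟩ := hO.exists_reaches_stepEdge hm (σ 1, σ 0)
    (hσ.visible 0 (by omega)).1 hu.neg r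
  obtain ⟨L₁, h3, h4, hc₁⟩ := hc.reaches hO hr₁
  obtain ⟨L₂, h5, h6, hc₂⟩ := hc₁.reverse.reaches hO hr₂
  have hc₃ := hc₂.reverse.shift (-(l₂ - u))
  have e1 : (shiftPair l₂ (stepEdge N (-u) r)).swap = shiftPair (l₂ - u) (stepEdge N u r) := by
    rw [shiftPair_swap, stepEdge_swap, shiftPair_shiftPair, neg_neg]
    congr 1
    abel
  rw [e1, Prod.swap_swap, shiftPair_shiftPair, shiftPair_shiftPair, add_neg_cancel,
    shiftPair_zero] at hc₃
  have hn₁' : (n₁ : ℝ) ≤ 7 := by exact_mod_cast hn₁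
  have hn₂' : (n₂ : ℝ) ≤ 7 := by exact_mod_cast hn₂
  have hB : (0 : ℝ) ≤ 1 + 2 * √m := by positivity
  -- The two extensions have at most seven edges each, and `u` contributes one more to the
  -- displacement: `15 = 7 + 7 + 1`.
  refine ⟨l₁ + -(l₂ - u), L₂, hc₃, ?_, ?_⟩
  · have h7 := mul_le_mul_of_nonneg_right hn₁' hB
    have h8 := mul_le_mul_of_nonneg_right hn₂' hB
    rw [abs_le]
    constructor <;> linarith
  · have h7 := hr₁.norm_le
    have h8 := hr₂.norm_le
    have h9 := hO.norm_sub_latticePoint_le (hmem 0 (by omega))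
    have h10 := hO.norm_sub_latticePoint_le (hmem (p + 1) le_rfl)
    simp only [shiftPair, stepEdge, shift_fst, latticePoint_add, latticePoint_neg] at h7 h8
    set A := latticePoint u + latticePoint l₁ - latticePoint (σ (p + 1)).1
    set B := -latticePoint u + latticePoint l₂ - latticePoint (σ 0).1
    set C := x 0 - latticePoint (σ 0).1
    set D := x (p + 1) - latticePoint (σ (p + 1)).1
    have e2 : latticePoint (l₁ + -(l₂ - u)) - displacement (p + 1) x = A - B + (C - D) - latticePoint u := by
      simp only [A, B, C, D, displacement, latticePoint_add, latticePoint_neg, latticePoint_sub]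
      abel
    rw [e2]
    have h11 := norm_sub_le (A - B + (C - D)) (latticePoint u)
    rw [hu.norm_latticePoint] at h11
    linarith [norm_add_le (A - B) (C - D), norm_sub_le A B, norm_sub_le C D]

/-! ### Rotation vectors as directions of long loops, and convexity. -/

/-- Take `ε = 1 / (n + 1)` and length at least `n + 1`: the bounded discrepancy between loop and
trajectory displacement vanishes after division by the length. -/
lemma mem_admissibleRotationSet_of_isLoop (hO : IsObstacleFamily O) {u : Fin m → ℤ}
    (hu : IsStep u) {r : Fin N} {v : Space m}
    (h : ∀ ε > 0, ∀ R, ∃ k L, IsLoop O (stepEdge N u r) k L ∧ R ≤ L ∧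
      ‖latticePoint k - L • v‖ ≤ ε * L) : v ∈ admissibleRotationSet O := by
  choose k L hloop hL hv using fun n : ℕ => h (1 / ((n : ℝ) + 1)) (by positivity) ((n : ℝ) + 1)
  choose p x hσ hlen hdisp using fun n => (hloop n).exists_isTrajectoryPiece hO hu
  refine ⟨p, x, hσ, ?_, Tendsto.mapClusterPt ?_⟩
  · simp only [hlen]
    exact tendsto_atTop_mono hL
      (tendsto_atTop_add_const_right _ _ tendsto_natCast_atTop_atTop)
  · rw [tendsto_iff_norm_sub_tendsto_zero]
    have hlim : Tendsto (fun n : ℕ => (1 + 2 * √m + 1) * (1 / ((n : ℝ) + 1))) atTop (𝓝 0) := by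
      simpa using tendsto_one_div_add_atTop_nhds_zero_nat.const_mul (1 + 2 * √m + 1)
    refine squeeze_zero (fun _ => norm_nonneg _) (fun n => ?_) hlim
    have hn : (0 : ℝ) < (n : ℝ) + 1 := by positivity
    have hL0 : 0 < L n := hn.trans_le (hL n)
    have e : (L n)⁻¹ • displacement (p n) (x n) - v = (L n)⁻¹ •
        ((displacement (p n) (x n) - latticePoint (k n)) + (latticePoint (k n) - L n • v)) := by
      rw [sub_add_sub_cancel, smul_sub, inv_smul_smul₀ hL0.ne']
    rw [hlen, e, norm_smul, norm_inv, Real.norm_of_nonneg hL0.le, inv_mul_le_iff₀ hL0]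
    have h1 : 1 ≤ L n * (1 / ((n : ℝ) + 1)) := by
      rw [mul_one_div, le_div_iff₀ hn, one_mul]
      exact hL n
    have h2 := norm_add_le (displacement (p n) (x n) - latticePoint (k n))
      (latticePoint (k n) - L n • v)
    have h3 : 0 ≤ 1 + 2 * √(m : ℝ) := by positivity
    nlinarith [hdisp n, hv n, mul_le_mul_of_nonneg_left h1 h3]

lemma exists_isLoop_of_mem_admissibleRotationSet (hO : IsObstacleFamily O) (hm : 2 ≤ m)
    {u : Fin m → ℤ} (hu : IsStep u) (r : Fin N) {v : Space m} (hv : v ∈ admissibleRotationSet O)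
    {ε : ℝ} (hε : 0 < ε) (R : ℝ) : ∃ k L, IsLoop O (stepEdge N u r) k L ∧ R ≤ L ∧
      ‖latticePoint k - L • v‖ ≤ ε * L := by
  obtain ⟨p, x, hσ, hlen, hcl⟩ := hv
  set C : ℝ := 15 * (1 + 2 * √m) with hC
  have hC0 : 0 ≤ C := by positivity
  have hfreq := hcl.frequently (Metric.ball_mem_nhds v (half_pos hε))
  -- The threshold gives `L ≥ R` and `2 * C * (1 + ‖v‖) ≤ ε * (L - C)`, so the errors of passing to
  -- a loop fit into the half of `ε` left by the ball.
  obtain ⟨n, hn, hn'⟩ := (hfreq.and_eventually (hlen.eventually_ge_atTop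
    (|R| + 1 + 2 * C + 2 * C * (1 + ‖v‖) / ε))).exists
  set ℓ := pieceLength (p n) (x n) with hℓ
  have hquot : 0 ≤ 2 * C * (1 + ‖v‖) / ε := by positivity
  have hℓ0 : 0 < ℓ := by linarith [abs_nonneg R]
  obtain ⟨σ, hadm, htraj⟩ := hσ n
  obtain ⟨q, hq⟩ : ∃ q, p n = q + 1 := by
    refine Nat.exists_eq_succ_of_ne_zero fun h0 => hℓ0.ne' ?_
    simp [hℓ, h0, pieceLength]
  have hw := hadm.isWalk
  rw [hq] at htraj hw
  obtain ⟨k, L, hloop, h1, h2⟩ := htraj.exists_isLoop hO hm hu r hw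
  rw [← hq, ← hℓ, ← hC] at h1
  rw [← hq, ← hC] at h2
  rw [abs_le] at h1
  refine ⟨k, L, hloop, by linarith [le_abs_self R], ?_⟩
  have h3 : ‖displacement (p n) (x n) - ℓ • v‖ ≤ ε / 2 * ℓ := by
    have e : displacement (p n) (x n) - ℓ • v = ℓ • (ℓ⁻¹ • displacement (p n) (x n) - v) := by
      rw [smul_sub, smul_inv_smul₀ hℓ0.ne']
    rw [e, norm_smul, Real.norm_of_nonneg hℓ0.le, mul_comm]
    rw [dist_eq_norm] at hn
    exact mul_le_mul_of_nonneg_right hn.le hℓ0.le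
  have h4 : ‖(ℓ - L) • v‖ ≤ C * ‖v‖ := by
    rw [norm_smul]
    refine mul_le_mul_of_nonneg_right ?_ (norm_nonneg v)
    rw [Real.norm_eq_abs, abs_le]
    constructor <;> linarith
  have e : latticePoint k - L • v = (latticePoint k - displacement (p n) (x n)) +
      (displacement (p n) (x n) - ℓ • v) + (ℓ - L) • v := by
    rw [sub_smul]
    abel
  have h5 : 2 * C * (1 + ‖v‖) ≤ ε * (L - C) := by
    rw [← div_le_iff₀' hε]
    linarith [abs_nonneg R]
  rw [e]
  have h6 := norm_add_le ((latticePoint k - displacement (p n) (x n)) +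
      (displacement (p n) (x n) - ℓ • v)) ((ℓ - L) • v)
  have h7 := norm_add_le (latticePoint k - displacement (p n) (x n))
      (displacement (p n) (x n) - ℓ • v)
  nlinarith

/-- Repeating a loop sufficiently often one gets close to a given multiple of its direction. -/
lemma IsLoop.exists_approx (hO : IsObstacleFamily O) (hm : 2 ≤ m) {u : Fin m → ℤ} (hu : IsStep u)
    {r : Fin N} {k : Fin m → ℤ} {L : ℝ} (h : IsLoop O (stepEdge N u r) k L) (hL : 0 < L)
    {v : Space m} {ε : ℝ} (hv : ‖latticePoint k - L • v‖ ≤ ε * L) {T : ℝ} (hT : 0 ≤ T) :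
    ∃ k' L', IsLoop O (stepEdge N u r) k' L' ∧ |L' - T| ≤ (T / L + 2) * (1 + 2 * √m) + L ∧
      ‖latticePoint k' - T • v‖ ≤ ε * (T + L) + L * ‖v‖ := by
  set n := ⌈T / L⌉₊ with hn
  have h1 : T ≤ n * L := (div_le_iff₀ hL).1 (Nat.le_ceil _)
  have h2 : (n : ℝ) ≤ T / L + 1 := (Nat.ceil_lt_add_one (by positivity)).le
  have h3 : n * L ≤ T + L := by
    have := mul_le_mul_of_nonneg_right h2 hL.le
    rwa [add_mul, div_mul_cancel₀ _ hL.ne', one_mul] at this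
  have hε : 0 ≤ ε := nonneg_of_mul_nonneg_left ((norm_nonneg _).trans hv) hL
  obtain ⟨L', h4, h5⟩ := h.nsmul hO hm hu n
  refine ⟨n • k, L', h5, ?_, ?_⟩
  · have h6 : ((n : ℝ) + 1) * (1 + 2 * √m) ≤ (T / L + 2) * (1 + 2 * √m) :=
      mul_le_mul_of_nonneg_right (by linarith) (by positivity)
    rw [abs_le] at *
    constructor <;> linarith [h4.1, h4.2]
  · have e : latticePoint (n • k) - T • v =
        (n : ℝ) • (latticePoint k - L • v) + (n * L - T) • v := by
      rw [latticePoint_nsmul, smul_sub, sub_smul, smul_smul]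
      abel
    rw [e]
    refine (norm_add_le _ _).trans (add_le_add ?_ ?_)
    · rw [norm_smul, Real.norm_of_nonneg (Nat.cast_nonneg n)]
      have h6 := mul_le_mul_of_nonneg_left hv (Nat.cast_nonneg (α := ℝ) n)
      have h7 := mul_le_mul_of_nonneg_left h3 hε
      linarith
    · rw [norm_smul, Real.norm_of_nonneg (by linarith)]
      exact mul_le_mul_of_nonneg_right (by linarith) (norm_nonneg v)

/-- The directions that are approximated by long loops form a convex set. -/
lemma exists_isLoop_combination (hO : IsObstacleFamily O) (hm : 2 ≤ m) {u : Fin m → ℤ}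
    (hu : IsStep u) {r : Fin N} {v w : Space m}
    (hv : ∀ ε > 0, ∀ R, ∃ k L, IsLoop O (stepEdge N u r) k L ∧ R ≤ L ∧
      ‖latticePoint k - L • v‖ ≤ ε * L)
    (hw : ∀ ε > 0, ∀ R, ∃ k L, IsLoop O (stepEdge N u r) k L ∧ R ≤ L ∧
      ‖latticePoint k - L • w‖ ≤ ε * L)
    {a b : ℝ} (ha : 0 ≤ a) (hb : 0 ≤ b) (hab : a + b = 1) {ε : ℝ} (hε : 0 < ε) (R : ℝ) :
    ∃ k L, IsLoop O (stepEdge N u r) k L ∧ R ≤ L ∧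
      ‖latticePoint k - L • (a • v + b • w)‖ ≤ ε * L := by
  set z := a • v + b • w with hz
  set B : ℝ := 1 + 2 * √m with hB
  have hB0 : 0 < B := by positivity
  -- Total length `M` takes about `M / R'` repetitions at most, each with error `B`. The first
  -- summand keeps their sum below `M / 2`, the second keeps its effect on `M • z` below `ε / 8 *
  -- M`.
  set R' : ℝ := 2 * B + 8 * B * ‖z‖ / ε with hR'
  have hquot : 0 ≤ 8 * B * ‖z‖ / ε := by positivity
  have hR0 : 0 < R' := by linarith
  obtain ⟨k₁, L₁, h₁, hL₁, hd₁⟩ := hv (ε / 8) (by positivity) R'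
  obtain ⟨k₂, L₂, h₂, hL₂, hd₂⟩ := hw (ε / 8) (by positivity) R'
  have hL₁0 : 0 < L₁ := by linarith
  have hL₂0 : 0 < L₂ := by linarith
  set K : ℝ := 5 * B + L₁ + L₂ with hK
  set K' : ℝ := ε / 8 * (L₁ + L₂) + L₁ * ‖v‖ + L₂ * ‖w‖ + K * ‖z‖ with hK'
  have hK0 : 0 < K := by positivity
  have hK'0 : 0 < K' := by positivity
  -- `K` and `K'` collect the errors in length and displacement that depend only on the basic loops.
  -- Chosen after them, `M` absorbs `K' + ε * K` into `ε * M / 4` and makes `M / 2 - K` at least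
  -- `|R|`.
  set M : ℝ := 4 * (K' + ε * K) / ε + 2 * (|R| + K) with hM
  have hM1 : 2 * (|R| + K) ≤ M := by
    have : 0 ≤ 4 * (K' + ε * K) / ε := by positivity
    linarith
  have hM2 : 4 * (K' + ε * K) ≤ ε * M := by
    rw [← div_le_iff₀' hε]
    have : 0 ≤ 2 * (|R| + K) := by positivity
    linarith
  have hM0 : 0 ≤ M := le_trans (by positivity) hM1
  clear_value M
  obtain ⟨l₁, T₁, g₁, ht₁, hs₁⟩ := h₁.exists_approx hO hm hu hL₁0 hd₁ (mul_nonneg hM0 ha)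
  obtain ⟨l₂, T₂, g₂, ht₂, hs₂⟩ := h₂.exists_approx hO hm hu hL₂0 hd₂ (mul_nonneg hM0 hb)
  obtain ⟨T, ht, g⟩ := g₁.add hO hu g₂
  rw [← hB] at ht ht₁ ht₂
  have hq₁ : M * a / L₁ ≤ M * a / R' := div_le_div_of_nonneg_left (mul_nonneg hM0 ha) hR0 hL₁
  have hq₂ : M * b / L₂ ≤ M * b / R' := div_le_div_of_nonneg_left (mul_nonneg hM0 hb) hR0 hL₂
  have hq : M * a / R' + M * b / R' = M / R' := by
    rw [← add_div, ← mul_add, hab, mul_one]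
  have hlen : |T - M| ≤ M / R' * B + K := by
    have e : (M * a / L₁ + 2) * B + (M * b / L₂ + 2) * B ≤ (M / R' + 4) * B := by
      rw [← add_mul]
      exact mul_le_mul_of_nonneg_right (by linarith) hB0.le
    have e' : M * a + M * b = M := by rw [← mul_add, hab, mul_one]
    have e'' : T - M = (T - (T₁ + T₂)) + (T₁ - M * a) + (T₂ - M * b) := by linarith only [e']
    rw [e'']
    calc _ ≤ |T - (T₁ + T₂)| + |T₁ - M * a| + |T₂ - M * b| := abs_add_three _ _ _
      _ ≤ B + ((M * a / L₁ + 2) * B + L₁) + ((M * b / L₂ + 2) * B + L₂) :=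
        add_le_add (add_le_add ht ht₁) ht₂
      _ = ((M * a / L₁ + 2) * B + (M * b / L₂ + 2) * B) + (B + L₁ + L₂) := by ring
      _ ≤ (M / R' + 4) * B + (B + L₁ + L₂) := by linarith only [e]
      _ = M / R' * B + K := by rw [hK]; ring
  have hhalf : M / R' * B ≤ M / 2 := by
    rw [div_mul_eq_mul_div, div_le_iff₀ hR0]
    have := mul_le_mul_of_nonneg_left (show 2 * B ≤ R' by linarith only [hR', hquot]) hM0
    linarith only [this]
  have hsmall : M / R' * B * ‖z‖ ≤ ε / 8 * M := by
    have e : 8 * B * ‖z‖ ≤ ε * R' := by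
      rw [← div_le_iff₀' hε]
      linarith only [hR', hB0]
    rw [div_mul_eq_mul_div, div_mul_eq_mul_div, div_le_iff₀ hR0]
    have := mul_le_mul_of_nonneg_left e hM0
    linarith only [this]
  refine ⟨_, T, g, ?_, ?_⟩
  · have := (abs_le.1 hlen).1
    linarith only [this, le_abs_self R, hhalf, hM1]
  · have e : latticePoint (l₁ + l₂) - T • z = (latticePoint l₁ - (M * a) • v) +
        (latticePoint l₂ - (M * b) • w) - (T - M) • z := by
      rw [latticePoint_add, sub_smul T, hz, smul_add M, smul_smul, smul_smul]
      abel
    have h3 : ‖(T - M) • z‖ ≤ (M / R' * B + K) * ‖z‖ := by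
      rw [norm_smul]
      exact mul_le_mul_of_nonneg_right hlen (norm_nonneg z)
    have h4 := norm_sub_le ((latticePoint l₁ - (M * a) • v) + (latticePoint l₂ - (M * b) • w))
      ((T - M) • z)
    have h5 := norm_add_le (latticePoint l₁ - (M * a) • v) (latticePoint l₂ - (M * b) • w)
    have h6 : ε * (M / 2 - K) ≤ ε * T :=
      mul_le_mul_of_nonneg_left (by linarith only [(abs_le.1 hlen).1, hhalf]) hε.le
    have h7 : ε / 8 * (M * a) + ε / 8 * (M * b) = ε / 8 * M := by
      rw [← mul_add, ← mul_add, hab, mul_one]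
    rw [e]
    linarith only [h3, h4, h5, h6, h7, hs₁, hs₂, hsmall, hM2, hK']

end TorusBilliard

theorem mainTheorem1 {m N : ℕ} (hm : 2 ≤ m) (O : Fin N → Set (TorusBilliard.Space m))
    (hO : TorusBilliard.IsObstacleFamily O) :
    Convex ℝ (TorusBilliard.admissibleRotationSet O) := by
  intro v hv w hw a b ha hb hab
  have hu := TorusBilliard.isStep_single (⟨0, by omega⟩ : Fin m)
  -- For `N = 0` the rotation set is empty; a point of it supplies an obstacle for the base edge.
  obtain ⟨r⟩ : Nonempty (Fin N) := by
    obtain ⟨p, x, hσ, -⟩ := hv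
    obtain ⟨σ, -⟩ := hσ 0
    exact ⟨(σ 0).2⟩
  exact TorusBilliard.mem_admissibleRotationSet_of_isLoop hO hu fun ε hε R =>
    TorusBilliard.exists_isLoop_combination hO hm hu (r := r)
      (fun ε hε R => TorusBilliard.exists_isLoop_of_mem_admissibleRotationSet hO hm hu r hv hε R)
      (fun ε hε R => TorusBilliard.exists_isLoop_of_mem_admissibleRotationSet hO hm hu r hw hε R)
      ha hb hab hε R
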